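/- Let $S$ be a countable set (the vertex set of a graph), let $\eta_0:S\to\mathbb{N}\cup\{0\}$ be a deterministic initial occupation, and let $P$ be a Markov transition kernel on $S$. In the activated random walks (ARW) process with sleep rate $\lambda\in(0,\infty]$, $\eta_0(x)$ particles start at each vertex $x$, and each particle is active or asleep. Every particle carries a rate one Poisson jump clock and, if $\lambda<\infty$, a rate $\lambda$ Poisson sleep clock, all independent. When the jump clock of an active particle at $x$ rings, the particle jumps to a vertex chosen from $P(x,\cdot)$ independently of the past; sleeping particles do not move. If $\lambda<\infty$, all particles start active, a particle falls asleep when its sleep clock rings while it is alone at its vertex, and all particles at a vertex with at least two particles are active; a sleeping particle stays asleep as long as it is alone. If $\lambda=\infty$, a particle is asleep exactly when it is alone at its vertex. It is taken for granted that the process is well defined: it is nonanticipating, i.e. adapted to a filtration relative to which the clocks are Poisson processes and the jump destinations are chosen independently of the strict past, it has right-continuous paths with left limits, and only finitely many particles reach any given vertex in a finite time. The triple $(S,\eta_0,P)$ is called nonfixating at $x\in S$ if for every $\lambda\in(0,\infty]$ and every $r\in\mathbb{N}$, in the ARW process with sleep rate $\lambda$, almost surely there are at least $r$ distinct times at which an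 active particle jumps to $x$ from another vertex. Fix $\mathbf 0\in S$. Let $(X(t))_{t\ge 0}$ be the discrete time Markov chain with kernel $P$, write $P_x$ for its law started at $x$, and for $B\subset S$ let $\tau_B=\inf\{t\ge 0: X(t)\in B\}\in\mathbb{N}\cup\{0,\infty\}$. For a sequence $(A_m)_{m\in\mathbb{N}}$ of subsets of $S$ containing $\mathbf 0$ set $$p_x^m=P_x\big[\tau_{\{\mathbf 0\}}<\tau_{S\setminus A_m}\big],\qquad \Lambda_m=\sum_{x\in A_m}p_x^m,\qquad \Omega_m=\sum_{x\in A_m}\eta_0(x)\,p_x^m,\qquad \Delta_m=\Omega_m-\Lambda_m .$$ **Theorem.** If there is a sequence $(A_m)_{m\in\mathbb{N}}$ of subsets of $S$ containing $\mathbf 0$, with $\Lambda_m<\infty$ for all large $m$, such that $$\lim_{m\to\infty}\frac{\Delta_m}{\Lambda_m^{1/2}}=+\infty$$ (where $\Delta_m=+\infty$ is allowed), then $(S,\eta_0,P)$ is nonfixating at $\mathbf 0$. -/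

import Mathlib

open MeasureTheory ProbabilityTheory Filter Topology
open scoped NNReal ENNReal

universe u v

noncomputable section

namespace ARW

/-! ### Poisson clocks and left limits -/

section Clocks

variable {Ω : Type*} [mΩ : MeasurableSpace Ω]

/-- `N` is a family of independent Poisson counting processes with rates `rate`, relative to the
filtration `𝓕`: it is adapted, its paths start at `0`, are nondecreasing and right-continuous, and
the increments over `(s, t]` are Poisson, independent of each other and of `𝓕 s`. -/
structure IsPoissonClocks {κ : Type*} (𝓕 : Filtration ℝ≥0 mΩ) (N : κ → ℝ≥0 → Ω → ℕ)
    (rate : κ → ℝ≥0) (μ : Measure Ω) : Prop where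
  adapted : ∀ c t, Measurable[𝓕 t] (N c t)
  path : ∀ᵐ ω ∂μ, ∀ c, N c 0 ω = 0 ∧ Monotone (fun t => N c t ω) ∧
    ∀ t, ∀ᶠ s in 𝓝[>] t, N c s ω = N c t ω
  law : ∀ c s t, s ≤ t →
    μ.map (fun ω => N c t ω - N c s ω) = poissonMeasure (rate c * (t - s))
  indep : ∀ s t, s ≤ t → iIndepFun (fun c ω => N c t ω - N c s ω) μ
  indep_past : ∀ s t, s ≤ t →
    Indep (⨆ c, MeasurableSpace.comap (fun ω => N c t ω - N c s ω) ⊤) (𝓕 s) μ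

/-- The counting path `n` jumps (the clock rings) at time `t`. -/
def Rings (n : ℝ≥0 → ℕ) (t : ℝ≥0) : Prop := 0 < t ∧ ∀ s < t, n s < n t

/-- The time of the `(k+1)`-st ring of the counting process `N`. -/
def ringTime (N : ℝ≥0 → Ω → ℕ) (k : ℕ) (ω : Ω) : ℝ≥0 := sInf {t | k < N t ω}

/-- The `σ`-algebra `𝓕_{T-}` of events strictly before the random time `T`. -/
abbrev strictPast (𝓕 : Filtration ℝ≥0 mΩ) (T : Ω → ℝ≥0) : MeasurableSpace Ω :=
  𝓕 0 ⊔ MeasurableSpace.generateFrom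
    {G | ∃ (s : ℝ≥0) (A : Set Ω), MeasurableSet[𝓕 s] A ∧ G = A ∩ {ω | s < T ω}}

/-- The path `f` in a discrete space has left limit `a` at the time `t > 0`. -/
def JustBefore {α : Type*} (f : ℝ≥0 → α) (t : ℝ≥0) (a : α) : Prop :=
  0 < t ∧ ∀ᶠ s in 𝓝[<] t, f s = a

end Clocks

/-! ### Activated random walks -/

variable {S : Type u}

/-- The particles: `η₀ x` of them start at the vertex `x`. -/
abbrev Particle (η₀ : S → ℕ) : Type _ := Σ x : S, Fin (η₀ x)

/-- The deterministic rules obeyed by a trajectory of activated random walks, given the counting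
paths of the clocks; `Sum.inl i` is the jump clock and `Sum.inr i` the sleep clock of `i`. -/
structure IsPath (η₀ : S → ℕ) (lam : ℝ≥0∞)
    (n : Particle η₀ ⊕ Particle η₀ → ℝ≥0 → ℕ)
    (pos : Particle η₀ → ℝ≥0 → S) (awake : Particle η₀ → ℝ≥0 → Bool) : Prop where
  start : ∀ i, pos i 0 = i.1
  right_cont : ∀ i t, ∀ᶠ s in 𝓝[>] t, pos i s = pos i t ∧ awake i s = awake i t
  left_lim : ∀ i t, 0 < t → ∃ x a, JustBefore (fun s => (pos i s, awake i s)) t (x, a)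
  /-- Only finitely many particles reach a given vertex in finite time. -/
  locally_finite : ∀ x t, {i | ∃ s ≤ t, pos i s = x}.Finite
  /-- A particle can move only when its jump clock rings and it was active just before. -/
  stay : ∀ i t, 0 < t → ¬ (Rings (n (Sum.inl i)) t ∧ JustBefore (awake i) t true) →
    JustBefore (pos i) t (pos i t)
  /-- For a finite sleep rate all particles start active; at time `t > 0` a particle is active iff
  it shares its vertex, or it was active just before and its sleep clock does not ring. -/
  activity : lam ≠ ∞ → ∀ i, awake i 0 = true ∧ ∀ t, 0 < t →
    (awake i t = true ↔ (∃ j, j ≠ i ∧ pos j t = pos i t) ∨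
      (JustBefore (awake i) t true ∧ ¬ Rings (n (Sum.inr i)) t))
  /-- For an infinite sleep rate a particle is asleep iff it is alone at its vertex. -/
  activity_top : lam = ∞ → ∀ i t, (awake i t = true ↔ ∃ j, j ≠ i ∧ pos j t = pos i t)

variable [MeasurableSpace S]

/-- Activated random walks on `S` with initial occupation `η₀`, jump kernel `P` and sleep rate
`lam`, realized on the probability space `(Ω, μ)`. Every particle has a rate one jump clock and a
rate `lam` sleep clock, all independent; when the jump clock of an active particle at `x` rings,
the particle jumps to a vertex chosen from `P x` independently of the past. For `lam = ∞` the
sleep clocks have rate `0`, hence never ring, and play no role. -/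
structure ActivatedRandomWalk (η₀ : S → ℕ) (P : Kernel S S) (lam : ℝ≥0∞)
    {Ω : Type*} [mΩ : MeasurableSpace Ω] (μ : Measure Ω) where
  filtration : Filtration ℝ≥0 mΩ
  clock : Particle η₀ ⊕ Particle η₀ → ℝ≥0 → Ω → ℕ
  pos : Particle η₀ → ℝ≥0 → Ω → S
  awake : Particle η₀ → ℝ≥0 → Ω → Bool
  clocks : IsPoissonClocks filtration clock
    (Sum.elim (fun _ => 1) (fun _ => lam.toNNReal)) μ
  pos_adapted : ∀ i t, Measurable[filtration t] (pos i t)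
  awake_adapted : ∀ i t, Measurable[filtration t] (awake i t)
  path : ∀ᵐ ω ∂μ, IsPath η₀ lam (fun c t => clock c t ω)
    (fun i t => pos i t ω) (fun i t => awake i t ω)
  /-- Given the strict past of the `(k+1)`-st ring of its jump clock, a particle that was active
  at `x` just before this ring is moved to `y` with probability `P x {y}`. -/
  jump_law : ∀ (i : Particle η₀) (k : ℕ) (x y : S) (G : Set Ω),
    MeasurableSet[strictPast filtration (ringTime (clock (Sum.inl i)) k)] G →
    μ ({ω ∈ G | JustBefore (fun s => (pos i s ω, awake i s ω))
          (ringTime (clock (Sum.inl i)) k ω) (x, true) ∧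
          pos i (ringTime (clock (Sum.inl i)) k ω) ω = y}) =
      μ ({ω ∈ G | JustBefore (fun s => (pos i s ω, awake i s ω))
          (ringTime (clock (Sum.inl i)) k ω) (x, true)}) * P x {y}

/-- The set of times at which an active particle jumps to `x` from another vertex. -/
def ActivatedRandomWalk.visitTimes {η₀ : S → ℕ} {P : Kernel S S} {lam : ℝ≥0∞}
    {Ω : Type*} [MeasurableSpace Ω] {μ : Measure Ω}
    (X : ActivatedRandomWalk η₀ P lam μ) (x : S) (ω : Ω) : Set ℝ≥0 :=
  {t | ∃ i y, y ≠ x ∧ JustBefore (fun s => (X.pos i s ω, X.awake i s ω)) t (y, true) ∧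
    X.pos i t ω = x}

/-- `(S, η₀, P)` is nonfixating at `x`: for every sleep rate in `(0, ∞]` and every `r`, almost
surely `x` is visited by active particles at `r` or more distinct times. -/
def NonfixatingAt (η₀ : S → ℕ) (P : Kernel S S) (x : S) : Prop :=
  ∀ lam : ℝ≥0∞, 0 < lam →
    ∀ (Ω : Type v) [MeasurableSpace Ω] (μ : Measure Ω) [IsProbabilityMeasure μ]
      (X : ActivatedRandomWalk η₀ P lam μ) (r : ℕ),
      ∀ᵐ ω ∂μ, (r : ℕ∞) ≤ (X.visitTimes x ω).encard

/-! ### Hitting probabilities of the underlying Markov chain -/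

/-- The law on trajectories of the discrete time Markov chain with kernel `P` started at `x`. -/
def chainLaw (P : Kernel S S) [IsMarkovKernel P] (x : S) : Measure (ℕ → S) :=
  Kernel.trajMeasure (X := fun _ => S) (Measure.dirac x)
    (fun n => P.comap (fun h : (Π _ : Finset.Iic n, S) => h ⟨n, Finset.mem_Iic.2 le_rfl⟩)
      (measurable_pi_apply _))

/-- The hitting time `inf {t ≥ 0 | X t ∈ B}` of a trajectory, infinite if `B` is never hit. -/
def hitTime (B : Set S) (X : ℕ → S) : WithTop ℕ :=
  hittingAfter (fun (t : ℕ) (X : ℕ → S) => X t) B 0 X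

/-- The probability that the chain started at `x` hits `o` before exiting `A`. -/
def hitProb (P : Kernel S S) [IsMarkovKernel P] (o : S) (A : Set S) (x : S) : ℝ≥0∞ :=
  chainLaw P x {X | hitTime {o} X < hitTime Aᶜ X}

/-- The sum over `A` of the hitting probabilities. -/
def bigLambda (P : Kernel S S) [IsMarkovKernel P] (o : S) (A : Set S) : ℝ≥0∞ :=
  ∑' x : A, hitProb P o A x

/-- The sum over `A` of the hitting probabilities weighted by the initial occupation. -/
def bigOmega (η₀ : S → ℕ) (P : Kernel S S) [IsMarkovKernel P] (o : S) (A : Set S) : ℝ≥0∞ :=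
  ∑' x : A, (η₀ x : ℝ≥0∞) * hitProb P o A x

/-- The difference of the two sums, an extended real number (`⊥` if the unweighted sum is
infinite). -/
def bigDelta (η₀ : S → ℕ) (P : Kernel S S) [IsMarkovKernel P] (o : S) (A : Set S) : EReal :=
  (bigOmega η₀ P o A : EReal) - (bigLambda P o A : EReal)

end ARW

end

/-! Give each particle a score: the probability that a walk with kernel `P` from its current vertex
hits `o` before leaving `A`, within the steps it has left. The particle's record is stopped once it
hits `o`, leaves `A`, or has made `n` jumps. Since a jump is distributed as `P` given the strict
past of the ring, and nothing changes at a ring that finds the particle asleep, the score is a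
martingale in the number of rings (`setLIntegral_score_succ`).

Scores of different particles are uncorrelated even though the particles interact. Almost surely two
jump clocks never ring together, so of two increments one happens strictly earlier. It is known in
the strict past of the later one, whose conditional mean is zero (`integral_scoreIncr_mul`). For a
finite set `F` of particles the sum of scores therefore has mean `a`, the sum of the initial scores,
and variance at most `a`, because scores lie in `[0, 1]`.

On the other hand, every record is eventually constant. If `o` gets fewer than `r` visits, the final
sum of scores is small (`Regular.sum_hitWithin_le`). Particles recorded at `o` contribute at most
`η₀ o + r`; those outside `A`, or out of steps away from `o`, contribute nothing. The others rest
forever at distinct vertices, since two at one vertex would be active and one would jump at its next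
ring; these contribute at most `Λ`.

So few visits force the sum from mean `a` down to `η₀ o + r + Λ`, and Chebyshev bounds the
probability by `a / (a - Λ - η₀ o - r) ^ 2`. Taking `F` and `n` large makes `a` exceed `Λ + K √Λ`
for a suitable `A m`. The bound is then `O(1 / K)` with `K` arbitrary. The sleep rate enters
nowhere, only the rule that particles sharing a vertex are awake. -/

namespace ARW

/-! ### Hitting probabilities of the killed chain -/

section Hitting

variable {S : Type u} [MeasurableSpace S]

/-- One step of the chain killed on hitting `o` or exiting `A`. -/
noncomputable def killedStep (P : Kernel S S) (o : S) (A : Set S) (g : S → ℝ≥0∞) : S → ℝ≥0∞ :=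
  Set.indicator (A \ {o}) fun x => ∫⁻ y, g y ∂P x

/-- The probability that the chain hits `o` before exiting `A`, and within `n` steps. -/
noncomputable def hitWithin (P : Kernel S S) (o : S) (A : Set S) : ℕ → S → ℝ≥0∞
  | 0 => Set.indicator {o} 1
  | n + 1 => Set.indicator {o} 1 + killedStep P o A (hitWithin P o A n)

variable {P : Kernel S S} {o : S} {A : Set S}

lemma hitWithin_self (n : ℕ) : hitWithin P o A n o = 1 := by
  cases n <;> simp [hitWithin, killedStep]

lemma hitWithin_of_notMem (n : ℕ) {x : S} (hx : x ∉ A) (hxo : x ≠ o) :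
    hitWithin P o A n x = 0 := by
  cases n <;> simp [hitWithin, killedStep, hx, hxo]

lemma hitWithin_zero_of_ne {x : S} (hxo : x ≠ o) : hitWithin P o A 0 x = 0 := by
  simp [hitWithin, hxo]

lemma hitWithin_succ {n : ℕ} {x : S} (hx : x ∈ A) (hxo : x ≠ o) :
    hitWithin P o A (n + 1) x = ∫⁻ y, hitWithin P o A n y ∂P x := by
  simp [hitWithin, killedStep, hx, hxo]

lemma hitWithin_le_one [IsMarkovKernel P] (n : ℕ) (x : S) : hitWithin P o A n x ≤ 1 := by
  induction n generalizing x with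
  | zero => exact Set.indicator_le_self' (by simp) x
  | succ n ih =>
    by_cases hxo : x = o
    · rw [hxo, hitWithin_self]
    by_cases hx : x ∈ A
    · rw [hitWithin_succ hx hxo]
      calc ∫⁻ y, hitWithin P o A n y ∂P x ≤ ∫⁻ _, 1 ∂P x := lintegral_mono ih
        _ = 1 := by simp
    · simp [hitWithin_of_notMem _ hx hxo]

lemma map_eval_zero_chainLaw [IsMarkovKernel P] (x : S) :
    (chainLaw P x).map (fun X => X 0) = Measure.dirac x := by
  rw [chainLaw, Kernel.trajMeasure, Measure.map_comp _ _ (by fun_prop)]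
  have h : ∀ κ : (n : ℕ) → Kernel (Π _ : Finset.Iic n, S) S, ∀ [∀ n, IsMarkovKernel (κ n)],
      (Kernel.traj (X := fun _ => S) κ 0).map (fun X => X 0) =
        Kernel.deterministic (fun h : (Π _ : Finset.Iic 0, S) => h ⟨0, by simp⟩)
          (measurable_pi_apply _) := by
    intro κ _
    have := Kernel.traj_map_frestrictLe_of_le (X := fun _ => S) (κ := κ) (le_refl 0)
    have h2 : (fun X : ℕ → S => X 0) =
      (fun h : (Π _ : Finset.Iic 0, S) => h ⟨0, by simp⟩) ∘ Preorder.frestrictLe 0 := rfl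
    rw [h2, Kernel.map_comp_right _ (Preorder.measurable_frestrictLe (X := fun _ => S) 0)
      (by fun_prop), this,
      Kernel.deterministic_map _ (by fun_prop)]
    rfl
  have h3 : (Measure.dirac x).map (MeasurableEquiv.piUnique (fun _ : Finset.Iic 0 => S)).symm =
      Measure.dirac fun _ => x :=
    Measure.map_dirac' (MeasurableEquiv.piUnique (fun _ : Finset.Iic 0 => S)).symm.measurable x
  rw [h, Measure.deterministic_comp_eq_map]
  exact (congrArg (Measure.map fun h : (Π _ : Finset.Iic 0, S) => h ⟨0, by simp⟩) h3).trans
    (Measure.map_dirac' (by fun_prop) _)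

variable [DiscreteMeasurableSpace S]

/-- The `m`-th iterate is the probability that `o` is first hit at step exactly `m`, with the walk
in `A` until then. -/
lemma hitWithin_eq_sum (n : ℕ) :
    hitWithin P o A n =
      ∑ m ∈ Finset.range (n + 1), (killedStep P o A)^[m] (Set.indicator {o} 1) := by
  induction n with
  | zero => simp [hitWithin]
  | succ n ih =>
    rw [hitWithin, ih, Finset.sum_range_succ' _ (n + 1), add_comm]
    congr 1
    ext x
    simp only [killedStep, Finset.sum_apply, Function.iterate_succ', Function.comp_def]
    by_cases hx : x ∈ A \ {o}
    · simp only [Set.indicator_of_mem hx]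
      exact lintegral_finsetSum _ fun _ _ => .of_discrete
    · simp [Set.indicator_of_notMem hx]

variable [IsMarkovKernel P] [Countable S]

/-- The Markov property. The induction peels off the last step: integrating out coordinate `n + 1`
given the first ones replaces `g` by `killedStep P o A g`, which is why `g` is arbitrary. -/
lemma lintegral_chainLaw_killed (n : ℕ) (g : S → ℝ≥0∞) (x : S) :
    ∫⁻ X, Set.indicator {X | ∀ s < n, X s ∈ A \ {o}} (fun X => g (X n)) X ∂chainLaw P x =
      (killedStep P o A)^[n] g x := by
  induction n generalizing g with
  | zero =>
    have := lintegral_map (μ := chainLaw P x) (f := g) (g := fun X => X 0) .of_discrete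
      (by fun_prop)
    rw [map_eval_zero_chainLaw, lintegral_dirac] at this
    simp [this]
  | succ n ih =>
    rw [Function.iterate_succ_apply, ← ih]
    set κ : (n : ℕ) → Kernel (Π _ : Finset.Iic n, S) S := fun n =>
      P.comap (fun h : (Π _ : Finset.Iic n, S) => h ⟨n, Finset.mem_Iic.2 le_rfl⟩)
      (measurable_pi_apply _) with hκ
    set ν : Measure (ℕ → S) := chainLaw P x with hν
    have : IsProbabilityMeasure ν := inferInstanceAs (IsProbabilityMeasure
      (Kernel.trajMeasure (X := fun _ => S) (Measure.dirac x) κ))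
    have key : ν.map (Preorder.frestrictLe n) ⊗ₘ κ n =
        ν.map fun X => (Preorder.frestrictLe n X, X (n + 1)) :=
      Kernel.map_frestrictLe_trajMeasure_compProd_eq_map_trajMeasure
        (X := fun _ => S) (μ₀ := Measure.dirac x) (κ := κ) (a := n)
    clear_value ν
    set B : Set (Π _ : Finset.Iic n, S) := {h | ∀ i, h i ∈ A \ {o}} with hB
    have hBm : MeasurableSet B := by
      rw [hB, Set.ofPred_forall]
      exact MeasurableSet.iInter fun i => measurable_pi_apply i (.of_discrete (s := A \ {o}))
    set f : (Π _ : Finset.Iic n, S) × S → ℝ≥0∞ := fun p => B.indicator (fun _ => g p.2) p.1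
    have hf : Measurable f := by
      have : f = Set.indicator (B ×ˢ Set.univ) (fun p => g p.2) := by
        ext ⟨a, b⟩; by_cases h : a ∈ B <;> simp [f, h]
      rw [this]
      exact Measurable.indicator ((Measurable.of_discrete (f := g)).comp measurable_snd)
        (hBm.prod .univ)
    have h1 : ∀ X : ℕ → S, Set.indicator {X | ∀ s < n + 1, X s ∈ A \ {o}}
        (fun X => g (X (n + 1))) X = f (Preorder.frestrictLe n X, X (n + 1)) := by
      intro X
      by_cases h : ∀ s < n + 1, X s ∈ A \ {o}
      · have : Preorder.frestrictLe n X ∈ B := by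
          rintro ⟨i, hi⟩
          exact h i (Nat.lt_succ_of_le (Finset.mem_Iic.1 hi))
        simp only [f, Set.indicator_of_mem this]
        exact Set.indicator_of_mem (s := {X : ℕ → S | ∀ s < n + 1, X s ∈ A \ {o}}) h _
      · have : Preorder.frestrictLe n X ∉ B := by
          intro hb
          exact h fun s hs => hb ⟨s, Finset.mem_Iic.2 (Nat.le_of_lt_succ hs)⟩
        simp only [f, Set.indicator_of_notMem this]
        exact Set.indicator_of_notMem (s := {X : ℕ → S | ∀ s < n + 1, X s ∈ A \ {o}}) h _
    have h2 : ∀ X : ℕ → S, Set.indicator {X | ∀ s < n, X s ∈ A \ {o}}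
        (fun X => killedStep P o A g (X n)) X =
          ∫⁻ y, f (Preorder.frestrictLe n X, y) ∂(κ n (Preorder.frestrictLe n X)) := by
      intro X
      by_cases h : ∀ s < n + 1, X s ∈ A \ {o}
      · have hb : Preorder.frestrictLe n X ∈ B := by
          rintro ⟨i, hi⟩
          exact h i (Nat.lt_succ_of_le (Finset.mem_Iic.1 hi))
        simp only [f, Set.indicator_of_mem hb]
        rw [Set.indicator_of_mem (s := {X : ℕ → S | ∀ s < n, X s ∈ A \ {o}})
          (fun s hs => h s (by omega)), killedStep, Set.indicator_of_mem (h n (by omega))]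
        rfl
      · have hb : Preorder.frestrictLe n X ∉ B := by
          intro hb
          exact h fun s hs => hb ⟨s, Finset.mem_Iic.2 (Nat.le_of_lt_succ hs)⟩
        simp only [f, Set.indicator_of_notMem hb, lintegral_zero]
        rw [Set.indicator_apply_eq_zero]
        intro hX
        refine Set.indicator_of_notMem (fun hn => h fun s hs => ?_) _
        rcases Nat.lt_succ_iff_lt_or_eq.1 hs with h' | rfl
        · exact hX s h'
        · exact hn
    simp_rw [h1, h2]
    rw [← lintegral_map (f := f) (g := fun X : ℕ → S => (Preorder.frestrictLe n X, X (n + 1)))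
      hf (by fun_prop), ← key, Measure.lintegral_compProd hf,
      lintegral_map (Measurable.lintegral_kernel_prod_right' hf) (by fun_prop)]

/-- Decompose by the exact time at which `o` is hit. Since `o ∈ A`, a walk that stays in `A` until
it reaches `o` has not left `A` at that time either. -/
lemma hitProb_eq_tsum (ho : o ∈ A) (x : S) :
    hitProb P o A x = ∑' n, (killedStep P o A)^[n] (Set.indicator {o} 1) x := by
  set E : ℕ → Set (ℕ → S) := fun n => {X | (∀ s < n, X s ∈ A \ {o}) ∧ X n = o} with hE
  have hEm : ∀ n, MeasurableSet (E n) := by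
    intro n
    have : E n = (⋂ s, ⋂ (_ : s < n), {X | X s ∈ A \ {o}}) ∩ {X | X n = o} := by
      ext X; simp [E]
    rw [this]
    refine MeasurableSet.inter (MeasurableSet.iInter fun s => MeasurableSet.iInter fun _ =>
      measurable_pi_apply s (.of_discrete (s := A \ {o}))) ?_
    exact (measurable_pi_apply n : Measurable fun X : ℕ → S => X n)
      (MeasurableSet.of_discrete (s := ({o} : Set S)))
  have hEd : Pairwise (Function.onFun Disjoint E) := by
    intro m n hmn
    refine Set.disjoint_left.2 fun X hm hn => ?_
    rcases lt_or_gt_of_ne hmn with h | h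
    · exact (hn.1 m h).2 hm.2
    · exact (hm.1 n h).2 hn.2
  have hset : {X : ℕ → S | hitTime {o} X < hitTime Aᶜ X} = ⋃ n, E n := by
    ext X
    simp only [Set.mem_ofPred_eq, Set.mem_iUnion]
    constructor
    · intro h
      have hne : hitTime {o} X ≠ ⊤ := h.ne_top
      obtain ⟨n, hn⟩ := WithTop.ne_top_iff_exists.1 hne
      have hmem := hittingAfter_mem_set_of_ne_top hne
      refine ⟨n, fun s hs => ⟨?_, ?_⟩, ?_⟩
      · have hs' : (s : WithTop ℕ) < hitTime Aᶜ X := by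
          refine lt_trans ?_ h
          rw [← hn]; exact WithTop.coe_lt_coe.2 hs
        simpa using notMem_of_lt_hittingAfter hs' (Nat.zero_le s)
      · have hs' : (s : WithTop ℕ) < hitTime {o} X := by
          rw [← hn]; exact WithTop.coe_lt_coe.2 hs
        simpa using notMem_of_lt_hittingAfter hs' (Nat.zero_le s)
      · have : (hittingAfter (fun (t : ℕ) (X : ℕ → S) => X t) {o} 0 X).untopA = n := by
          change (hitTime {o} X).untopA = n
          rw [← hn]; rfl
        rw [this] at hmem
        exact hmem
    · rintro ⟨n, h1, h2⟩
      have ha : hitTime {o} X ≤ n :=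
        hittingAfter_le_of_mem (u := fun (t : ℕ) (X : ℕ → S) => X t) (Nat.zero_le n) h2
      refine lt_of_le_of_lt ha ?_
      by_contra hcon
      obtain ⟨j, ⟨-, hj⟩, hj'⟩ := hittingAfter_le_iff.1 (not_lt.1 hcon)
      rcases hj.lt_or_eq with h | h
      · exact hj' (h1 j h).1
      · rw [h] at hj'; exact hj' (h2 ▸ ho)
  rw [hitProb, hset, measure_iUnion hEd hEm]
  congr 1
  ext n
  rw [← lintegral_chainLaw_killed, ← lintegral_indicator_one (hEm n)]
  congr 1
  ext X
  by_cases h : ∀ s < n, X s ∈ A \ {o}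
  · rw [Set.indicator_of_mem (s := {X : ℕ → S | ∀ s < n, X s ∈ A \ {o}}) h]
    by_cases h2 : X n = o
    · rw [Set.indicator_of_mem (s := E n) ⟨h, h2⟩]; simp [h2]
    · rw [Set.indicator_of_notMem (s := E n) (fun h' => h2 h'.2)]; simp [h2]
  · rw [Set.indicator_of_notMem (s := {X : ℕ → S | ∀ s < n, X s ∈ A \ {o}}) h,
      Set.indicator_of_notMem (s := E n) (fun h' => h h'.1)]

lemma tendsto_hitWithin (ho : o ∈ A) (x : S) :
    Tendsto (fun n => hitWithin P o A n x) atTop (𝓝 (hitProb P o A x)) := by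
  rw [hitProb_eq_tsum ho]
  have := (ENNReal.tendsto_nat_tsum
    fun n => (killedStep P o A)^[n] (Set.indicator {o} 1) x).comp (tendsto_add_atTop_nat 1)
  refine this.congr fun n => ?_
  simp [hitWithin_eq_sum]

lemma hitWithin_le_hitProb (ho : o ∈ A) (n : ℕ) (x : S) :
    hitWithin P o A n x ≤ hitProb P o A x := by
  rw [hitProb_eq_tsum ho, hitWithin_eq_sum, Finset.sum_apply]
  exact ENNReal.sum_le_tsum _

lemma hitProb_of_notMem (ho : o ∈ A) {x : S} (hx : x ∉ A) : hitProb P o A x = 0 := by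
  have h := tendsto_hitWithin (P := P) ho x
  simp only [hitWithin_of_notMem _ hx (fun h => hx (h ▸ ho))] at h
  exact tendsto_nhds_unique h tendsto_const_nhds

lemma one_le_bigLambda (ho : o ∈ A) : 1 ≤ bigLambda P o A := by
  calc (1 : ℝ≥0∞) = hitWithin P o A 0 o := (hitWithin_self 0).symm
    _ ≤ hitProb P o A o := hitWithin_le_hitProb ho 0 o
    _ ≤ _ := ENNReal.le_tsum (f := fun x : A => hitProb P o A x) ⟨o, ho⟩

lemma bigOmega_eq_tsum_particle (η₀ : S → ℕ) (ho : o ∈ A) :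
    bigOmega η₀ P o A = ∑' i : Particle η₀, hitProb P o A i.1 := by
  rw [ENNReal.tsum_sigma (fun (x : S) (_ : Fin (η₀ x)) => hitProb P o A x), bigOmega,
    tsum_subtype A fun x => (η₀ x : ℝ≥0∞) * hitProb P o A x]
  congr 1
  ext x
  by_cases hx : x ∈ A
  · simp [hx]
  · simp [hx, hitProb_of_notMem ho hx]

end Hitting

/-! ### Regularity of Poisson clocks -/

section Clocks

lemma poissonMeasure_one_le (r : ℝ≥0) : poissonMeasure r {n | 1 ≤ n} ≤ r := by
  have h : {n : ℕ | 1 ≤ n} = {0}ᶜ := by ext n; simp [Nat.one_le_iff_ne_zero]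
  have h1 : (poissonMeasure r).real {n | 1 ≤ n} ≤ r := by
    rw [h, probReal_compl_eq_one_sub .of_discrete, poissonMeasure_real_singleton]
    have := Real.add_one_le_exp (-(r : ℝ))
    simp only [pow_zero, mul_one, Nat.factorial_zero, Nat.cast_one, div_one]
    linarith
  rw [← ofReal_measureReal]
  exact ENNReal.ofReal_le_of_le_toReal (by simpa using h1)

/-- From `exp (-r) ≥ 1 - r` the probability is at most `1 - (1 - r) * (1 + r)`. The quadratic order
is what makes a union bound over a fine grid vanish. -/
lemma poissonMeasure_two_le (r : ℝ≥0) : poissonMeasure r {n | 2 ≤ n} ≤ (r : ℝ≥0∞) ^ 2 := by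
  have h : {n : ℕ | 2 ≤ n} = ({0} ∪ {1})ᶜ := by
    ext n
    simp only [Set.mem_ofPred_eq, Set.mem_compl_iff, Set.mem_union, Set.mem_singleton_iff]
    omega
  have h1 : (poissonMeasure r).real {n | 2 ≤ n} ≤ (r : ℝ) ^ 2 := by
    rw [h, probReal_compl_eq_one_sub .of_discrete, measureReal_union (by simp) .of_discrete,
      poissonMeasure_real_singleton, poissonMeasure_real_singleton]
    have h2 := Real.add_one_le_exp (-(r : ℝ))
    have h3 : (0 : ℝ) ≤ r := r.2
    simp only [pow_zero, mul_one, Nat.factorial_zero, Nat.cast_one, div_one, pow_one,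
      Nat.factorial_one]
    nlinarith
  rw [← ofReal_measureReal]
  exact ENNReal.ofReal_le_of_le_toReal (by simpa using h1)

lemma tendsto_poissonMeasure_le (k : ℕ) :
    Tendsto (fun t : ℕ => poissonMeasure t {n | n ≤ k}) atTop (𝓝 0) := by
  have h : ∀ t : ℕ, (poissonMeasure t).real {n | n ≤ k} =
      ∑ j ∈ Finset.range (k + 1), (t : ℝ) ^ j * Real.exp (-(t : ℝ)) / (j.factorial : ℝ) := by
    intro t
    have : {n : ℕ | n ≤ k} = (Finset.range (k + 1) : Set ℕ) := by
      ext n; simp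
    rw [this, ← sum_measureReal_singleton]
    refine Finset.sum_congr rfl fun j _ => ?_
    rw [poissonMeasure_real_singleton]
    simp [mul_comm]
  have h2 : Tendsto (fun t : ℕ => (poissonMeasure t).real {n | n ≤ k}) atTop (𝓝 0) := by
    simp_rw [h]
    have : ∀ j ∈ Finset.range (k + 1), Tendsto
        (fun t : ℕ => (t : ℝ) ^ j * Real.exp (-(t : ℝ)) / (j.factorial : ℝ)) atTop (𝓝 0) := by
      intro j _
      simpa using ((Real.tendsto_pow_mul_exp_neg_atTop_nhds_zero j).comp
        tendsto_natCast_atTop_atTop).div_const (j.factorial : ℝ)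
    simpa using tendsto_finsetSum _ this
  have := (ENNReal.tendsto_ofReal h2)
  simpa [ofReal_measureReal] using this

section Regularity

variable {Ω : Type*}

/-- The regularity of the paths of a Poisson clock: nondecreasing, right-continuous, unbounded,
and with all jumps of size one. -/
structure RegularClock (N : ℝ≥0 → Ω → ℕ) (ω : Ω) : Prop where
  zero : N 0 ω = 0
  mono : Monotone fun t => N t ω
  right_cont : ∀ t, ∀ᶠ s in 𝓝[>] t, N s ω = N t ω
  unbounded : ∀ k, ∃ t, k < N t ω
  ringTime_lt : ∀ k, ringTime N k ω < ringTime N (k + 1) ω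

variable {N : ℝ≥0 → Ω → ℕ} {ω : Ω}

/-- Right-continuity makes the infimum defining the ring time attained. -/
lemma ringTime_le_iff (hm : Monotone fun t => N t ω)
    (hr : ∀ t, ∀ᶠ s in 𝓝[>] t, N s ω = N t ω) (hu : ∀ k, ∃ t, k < N t ω) {k : ℕ} {t : ℝ≥0} :
    ringTime N k ω ≤ t ↔ k < N t ω := by
  constructor
  · intro h
    suffices k < N (ringTime N k ω) ω from this.trans_le (hm h)
    obtain ⟨u, hTu, hu'⟩ := (mem_nhdsGT_iff_exists_Ioo_subset
      (s := {s | N s ω = N (ringTime N k ω) ω})).1 (hr (ringTime N k ω))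
    obtain ⟨s, hs, hsu⟩ := exists_lt_of_csInf_lt (s := {t | k < N t ω}) (hu k) hTu
    have hTs : ringTime N k ω ≤ s := csInf_le (OrderBot.bddBelow _) hs
    rcases hTs.eq_or_lt with h' | h'
    · rw [h']; exact hs
    · have := hu' ⟨h', hsu⟩
      exact (show N s ω = _ from this) ▸ hs
  · intro h
    exact csInf_le (OrderBot.bddBelow _) h

lemma RegularClock.ringTime_le_iff (h : RegularClock N ω) {k : ℕ} {t : ℝ≥0} :
    ringTime N k ω ≤ t ↔ k < N t ω :=
  ARW.ringTime_le_iff h.mono h.right_cont h.unbounded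

lemma RegularClock.lt_ringTime_iff (h : RegularClock N ω) {k : ℕ} {t : ℝ≥0} :
    t < ringTime N k ω ↔ N t ω ≤ k := by
  rw [← not_le, h.ringTime_le_iff, not_lt]

lemma RegularClock.strictMono (h : RegularClock N ω) : StrictMono fun k => ringTime N k ω :=
  strictMono_nat_of_lt_succ h.ringTime_lt

lemma RegularClock.ringTime_pos (h : RegularClock N ω) (k : ℕ) : 0 < ringTime N k ω := by
  rw [h.lt_ringTime_iff, h.zero]; exact Nat.zero_le k

lemma RegularClock.exists_eq_ringTime (h : RegularClock N ω) {t : ℝ≥0}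
    (ht : Rings (fun s => N s ω) t) : ∃ k, t = ringTime N k ω := by
  have hpos : 0 < N t ω := lt_of_le_of_lt (Nat.zero_le _) (ht.2 0 ht.1)
  -- Before a ring at `t` the count is at most `N t ω - 1`, and at `t` it exceeds this; hence this
  -- index.
  refine ⟨N t ω - 1, le_antisymm (le_of_forall_lt fun s hs => ?_) ?_⟩
  · rw [h.lt_ringTime_iff]
    exact Nat.le_sub_one_of_lt (ht.2 s hs)
  · rw [h.ringTime_le_iff]; omega

lemma RegularClock.exists_lt_ringTime (h : RegularClock N ω) (t : ℝ≥0) (k : ℕ) :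
    ∃ m ≥ k, t < ringTime N m ω :=
  ⟨max k (N t ω), le_max_left _ _, h.lt_ringTime_iff.2 (le_max_right _ _)⟩

end Regularity

variable {Ω : Type*} [mΩ : MeasurableSpace Ω] {μ : Measure Ω}

/-- If having a common property on `(s, u]` has probability at most `(u - s) ^ 2`, then almost
surely no point has this property on all its neighborhoods. -/
lemma measure_exists_forall_interval_eq_zero (B : ℝ≥0 → ℝ≥0 → Set Ω)
    (hB : ∀ s u, s ≤ u → μ (B s u) ≤ ((u - s : ℝ≥0) : ℝ≥0∞) ^ 2) :
    μ {ω | ∃ t, 0 < t ∧ ∀ s < t, ∀ u, t ≤ u → ω ∈ B s u} = 0 := by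
  have hR : ∀ R : ℕ, μ {ω | ∃ t ≤ (R : ℝ≥0), 0 < t ∧ ∀ s < t, ∀ u, t ≤ u → ω ∈ B s u} = 0 := by
    intro R
    have hM : ∀ M : ℕ, μ {ω | ∃ t ≤ (R : ℝ≥0), 0 < t ∧ ∀ s < t, ∀ u, t ≤ u → ω ∈ B s u} ≤
        ((R / ((M : ℝ≥0) + 1) : ℝ≥0) : ℝ≥0∞) := by
      intro M
      set δ : ℝ≥0 := ((M : ℝ≥0) + 1)⁻¹ with hδ
      have hM0 : (M : ℝ≥0) + 1 ≠ 0 := by positivity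
      have hδ0 : 0 < δ := by positivity
      -- The point `t` lies in the grid cell `(m δ, (m + 1) δ]` with `m + 1 = ⌈t / δ⌉`. There are `R
      -- (M + 1)` cells, each of cost `δ ^ 2`, for a total of `R / (M + 1)`.
      have hsub : {ω | ∃ t ≤ (R : ℝ≥0), 0 < t ∧ ∀ s < t, ∀ u, t ≤ u → ω ∈ B s u} ⊆
          ⋃ m ∈ Finset.range (R * (M + 1)), B (m * δ) ((m + 1 : ℕ) * δ) := by
        rintro ω ⟨t, htR, ht0, ht⟩
        have hpos : 0 < t * ((M : ℝ≥0) + 1) := by positivity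
        have hc0 : 0 < ⌈t * ((M : ℝ≥0) + 1)⌉₊ := Nat.ceil_pos.2 hpos
        obtain ⟨m, hm⟩ := Nat.exists_eq_add_one_of_ne_zero hc0.ne'
        have h1 : (m : ℝ≥0) < t * ((M : ℝ≥0) + 1) := Nat.lt_ceil.1 (by omega)
        have h2 : t * ((M : ℝ≥0) + 1) ≤ ((m + 1 : ℕ) : ℝ≥0) := hm ▸ Nat.le_ceil _
        have h3 : m < R * (M + 1) := by
          have : (m : ℝ≥0) < ((R * (M + 1) : ℕ) : ℝ≥0) := by
            push_cast
            exact h1.trans_le (by gcongr)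
          exact_mod_cast this
        simp only [Set.mem_iUnion, Finset.mem_range]
        refine ⟨m, h3, ht _ ?_ _ ?_⟩
        · rw [hδ, ← div_eq_mul_inv, div_lt_iff₀ (by positivity)]; exact h1
        · rw [hδ, ← div_eq_mul_inv, le_div_iff₀ (by positivity)]; exact h2
      calc μ _ ≤ ∑ m ∈ Finset.range (R * (M + 1)), μ (B (m * δ) ((m + 1 : ℕ) * δ)) :=
            (measure_mono hsub).trans (measure_biUnion_finset_le _ _)
        _ ≤ ∑ m ∈ Finset.range (R * (M + 1)), ((δ : ℝ≥0∞)) ^ 2 := by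
            refine Finset.sum_le_sum fun m _ => (hB _ _ (by gcongr; omega)).trans_eq ?_
            congr 2
            push_cast
            rw [add_mul, one_mul, add_tsub_cancel_left]
        _ = _ := by
            rw [Finset.sum_const, Finset.card_range, nsmul_eq_mul]
            norm_cast
            rw [hδ]
            push_cast
            field_simp
    have hlim : Tendsto (fun M : ℕ => ((R / ((M : ℝ≥0) + 1) : ℝ≥0) : ℝ≥0∞)) atTop (𝓝 0) := by
      have : Tendsto (fun M : ℕ => (R / ((M : ℝ≥0) + 1) : ℝ≥0)) atTop (𝓝 0) := by
        rw [← NNReal.tendsto_coe]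
        push_cast
        exact tendsto_const_nhds.div_atTop
          (tendsto_atTop_add_const_right _ _ tendsto_natCast_atTop_atTop)
      rw [← ENNReal.coe_zero]
      exact ENNReal.tendsto_coe.2 this
    exact le_antisymm (ge_of_tendsto' hlim hM) zero_le
  refine measure_mono_null ?_ (measure_iUnion_null hR)
  rintro ω ⟨t, h⟩
  obtain ⟨R, hR⟩ := exists_nat_ge t
  exact Set.mem_iUnion.2 ⟨R, t, hR, h⟩

variable {κ : Type*} {𝓕 : Filtration ℝ≥0 mΩ} {N : κ → ℝ≥0 → Ω → ℕ} {rate : κ → ℝ≥0}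

lemma IsPoissonClocks.measurable (h : IsPoissonClocks 𝓕 N rate μ) (c : κ) (t : ℝ≥0) :
    Measurable (N c t) :=
  (h.adapted c t).mono (𝓕.le t) le_rfl

lemma IsPoissonClocks.measurable_sub (h : IsPoissonClocks 𝓕 N rate μ) (c : κ) (s t : ℝ≥0) :
    Measurable fun ω => N c t ω - N c s ω :=
  (h.measurable c t).sub (h.measurable c s)

lemma IsPoissonClocks.ae_unbounded (h : IsPoissonClocks 𝓕 N rate μ) {c : κ} (hc : rate c = 1) :
    ∀ᵐ ω ∂μ, ∀ k, ∃ t, k < N c t ω := by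
  rw [ae_all_iff]
  intro k
  have hle : ∀ t : ℕ, μ {ω | ¬ ∃ t, k < N c t ω} ≤ poissonMeasure t {n | n ≤ k} := by
    intro t
    have := h.law c 0 t zero_le
    rw [hc, one_mul, tsub_zero] at this
    rw [← this, Measure.map_apply (h.measurable_sub c 0 t) .of_discrete]
    refine measure_mono fun ω hω => ?_
    have h2 : N c t ω ≤ k := by
      by_contra hcon
      exact hω ⟨t, not_le.1 hcon⟩
    exact (Nat.sub_le _ _).trans h2
  exact le_antisymm (ge_of_tendsto' (tendsto_poissonMeasure_le k) hle) zero_le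

/-- If consecutive ring times coincided, every interval around them would contain two rings, an
event of quadratically small probability. -/
lemma IsPoissonClocks.ae_ringTime_lt (h : IsPoissonClocks 𝓕 N rate μ) {c : κ}
    (hc : rate c = 1) : ∀ᵐ ω ∂μ, ∀ k, ringTime (N c) k ω < ringTime (N c) (k + 1) ω := by
  have h0 := measure_exists_forall_interval_eq_zero (μ := μ)
    (fun s u => {ω | 2 ≤ N c u ω - N c s ω}) (by
      intro s u hsu
      have := h.law c s u hsu
      rw [hc, one_mul] at this
      have h2 := poissonMeasure_two_le (u - s)
      rw [← this, Measure.map_apply (h.measurable_sub c s u) .of_discrete] at h2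
      exact h2)
  filter_upwards [h.path, h.ae_unbounded hc, measure_eq_zero_iff_ae_notMem.1 h0] with ω h1 h2 h3 k
  obtain ⟨hz, hm, hr⟩ := h1 c
  by_contra hcon
  refine h3 ⟨ringTime (N c) k ω, ?_, fun s hs u hu => ?_⟩
  · by_contra h'
    have := (ringTime_le_iff hm hr h2).1 (not_lt.1 h')
    omega
  · have ha := (ringTime_le_iff hm hr h2).1 ((not_lt.1 hcon).trans hu)
    have hb := mt (ringTime_le_iff hm hr h2).2 (not_le.2 hs)
    change 2 ≤ N c u ω - N c s ω
    omega

lemma IsPoissonClocks.ae_regularClock (h : IsPoissonClocks 𝓕 N rate μ) {c : κ}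
    (hc : rate c = 1) : ∀ᵐ ω ∂μ, RegularClock (N c) ω := by
  filter_upwards [h.path, h.ae_unbounded hc, h.ae_ringTime_lt hc] with ω h1 h2 h3
  exact ⟨(h1 c).1, (h1 c).2.1, (h1 c).2.2, h2, h3⟩

/-- At a common ring time both clocks ring in every surrounding interval; by independence this has
probability at most the square of the length. -/
lemma IsPoissonClocks.ae_ringTime_ne (h : IsPoissonClocks 𝓕 N rate μ) {c c' : κ}
    (hc : rate c = 1) (hc' : rate c' = 1) (hne : c ≠ c') (k l : ℕ) :
    ∀ᵐ ω ∂μ, ringTime (N c) k ω ≠ ringTime (N c') l ω := by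
  have h0 := measure_exists_forall_interval_eq_zero (μ := μ)
    (fun s u => {ω | 1 ≤ N c u ω - N c s ω} ∩ {ω | 1 ≤ N c' u ω - N c' s ω}) (by
      intro s u hsu
      have hb : ∀ c, rate c = 1 → μ {ω | 1 ≤ N c u ω - N c s ω} ≤ ((u - s : ℝ≥0) : ℝ≥0∞) := by
        intro c hc
        have := h.law c s u hsu
        rw [hc, one_mul] at this
        have h2 := poissonMeasure_one_le (u - s)
        rw [← this,
          Measure.map_apply (h.measurable_sub c s u) .of_discrete] at h2
        exact h2
      have := ((h.indep s u hsu).indepFun hne).measure_inter_preimage_eq_mul {n | 1 ≤ n}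
        {n | 1 ≤ n} .of_discrete .of_discrete
      refine (this.le.trans (mul_le_mul' (hb c hc) (hb c' hc'))).trans_eq (sq _).symm)
  filter_upwards [h.ae_regularClock hc, h.ae_regularClock hc',
    measure_eq_zero_iff_ae_notMem.1 h0] with ω h1 h2 h3 heq
  refine h3 ⟨ringTime (N c) k ω, h1.ringTime_pos k, fun s hs u hu => ⟨?_, ?_⟩⟩
  · have ha := h1.ringTime_le_iff.1 hu
    have hb := h1.lt_ringTime_iff.1 hs
    change 1 ≤ N c u ω - N c s ω
    omega
  · rw [heq] at hs hu
    have ha := h2.ringTime_le_iff.1 hu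
    have hb := h2.lt_ringTime_iff.1 hs
    change 1 ≤ N c' u ω - N c' s ω
    omega

end Clocks

/-! ### Deterministic analysis of trajectories -/

section Paths

lemma JustBefore.unique {α : Type*} {f : ℝ≥0 → α} {t : ℝ≥0} {a b : α}
    (ha : JustBefore f t a) (hb : JustBefore f t b) : a = b := by
  have : (𝓝[<] t).NeBot := nhdsLT_neBot_of_exists_lt ⟨0, ha.1⟩
  obtain ⟨s, h1, h2⟩ := (ha.2.and hb.2).exists
  exact h1.symm.trans h2

lemma JustBefore.of_forall {α : Type*} {f : ℝ≥0 → α} {s t : ℝ≥0} {a : α} (hst : s < t)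
    (h : ∀ u, s ≤ u → u < t → f u = a) : JustBefore f t a :=
  ⟨pos_of_gt hst, by
    filter_upwards [Ioo_mem_nhdsLT hst] with u hu using h u hu.1.le hu.2⟩

variable {S : Type u} {η₀ : S → ℕ} {lam : ℝ≥0∞}

lemma IsPath.pos_eq {n : Particle η₀ ⊕ Particle η₀ → ℝ≥0 → ℕ} {pos : Particle η₀ → ℝ≥0 → S}
    {awake : Particle η₀ → ℝ≥0 → Bool} (h : IsPath η₀ lam n pos awake) (i : Particle η₀)
    {s t : ℝ≥0} (hst : s ≤ t)
    (hno : ∀ u, s < u → u ≤ t → ¬ (Rings (n (Sum.inl i)) u ∧ JustBefore (awake i) u true)) :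
    pos i t = pos i s := by
  -- With `S` discrete, the trajectory is continuous on `[s, t]`: on the right by right-continuity,
  -- on the left because no effective ring occurs in `(s, t]`. A continuous map from an interval to
  -- a discrete space is constant.
  let _ : TopologicalSpace S := ⊥
  have : DiscreteTopology S := ⟨rfl⟩
  refine isPreconnected_Icc.constant (f := pos i) (s := Set.Icc s t) (fun u hu => ?_)
    (Set.right_mem_Icc.2 hst) (Set.left_mem_Icc.2 hst)
  have hright : ∀ᶠ v in 𝓝[≥] u, pos i v = pos i u := by
    rw [← Set.Ioi_insert, nhdsWithin_insert, eventually_sup]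
    exact ⟨by simp, (h.right_cont i u).mono fun _ hv => hv.1⟩
  rw [ContinuousWithinAt, nhds_discrete, tendsto_pure]
  rcases hu.1.eq_or_lt with rfl | hsu
  · exact hright.filter_mono (nhdsWithin_mono _ fun v hv => hv.1)
  · refine Eventually.filter_mono nhdsWithin_le_nhds ?_
    rw [← nhdsLT_sup_nhdsGE, eventually_sup]
    exact ⟨(h.stay i u (pos_of_gt hsu) (hno u hsu hu.2)).2, hright⟩

lemma IsPath.awake_of_shared {n : Particle η₀ ⊕ Particle η₀ → ℝ≥0 → ℕ}
    {pos : Particle η₀ → ℝ≥0 → S} {awake : Particle η₀ → ℝ≥0 → Bool}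
    (h : IsPath η₀ lam n pos awake) {i j : Particle η₀} (hij : j ≠ i) {t : ℝ≥0} (ht : 0 < t)
    (hp : pos j t = pos i t) : awake i t = true := by
  by_cases hl : lam = ∞
  · exact (h.activity_top hl i t).2 ⟨j, hij, hp⟩
  · exact ((h.activity hl i).2 t ht).2 (.inl ⟨j, hij, hp⟩)

/-- The states of a walk from which it goes on: it has neither hit `o` nor left `A`, and there are
steps left. -/
def Alive (o : S) (A : Set S) (c : S × ℕ) : Prop := c.1 ∈ A ∧ c.1 ≠ o ∧ 0 < c.2

namespace ActivatedRandomWalk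

variable [MeasurableSpace S] {P : Kernel S S} {Ω : Type v} [mΩ : MeasurableSpace Ω]
  {μ : Measure Ω} (X : ActivatedRandomWalk η₀ P lam μ)

/-- The time of the `(k+1)`-st ring of the jump clock of the particle `i`. -/
noncomputable def jumpTime (i : Particle η₀) (k : ℕ) (ω : Ω) : ℝ≥0 :=
  ringTime (X.clock (Sum.inl i)) k ω

/-- The particle `i` is active at `x` just before the `(k+1)`-st ring of its jump clock. -/
def ActiveAt (i : Particle η₀) (k : ℕ) (x : S) (ω : Ω) : Prop :=
  JustBefore (fun s => (X.pos i s ω, X.awake i s ω)) (X.jumpTime i k ω) (x, true)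

open Classical in
/-- The position of the particle `i` and the number of steps left to it after `k` rings of its jump
clock, if it is stopped on hitting `o`, on exiting `A` and after `n` steps. -/
noncomputable def state (o : S) (A : Set S) (n : ℕ) (i : Particle η₀) : ℕ → Ω → S × ℕ
  | 0, _ => (i.1, n)
  | k + 1, ω =>
    if Alive o A (state o A n i k ω) ∧ X.ActiveAt i k (state o A n i k ω).1 ω then
      (X.pos i (X.jumpTime i k ω) ω, (state o A n i k ω).2 - 1)
    else state o A n i k ω

/-- The outcomes for which the trajectory obeys the rules, the jump clocks are regular and never
ring simultaneously. -/
structure Regular (ω : Ω) : Prop where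
  path : IsPath η₀ lam (fun c t => X.clock c t ω) (fun i t => X.pos i t ω)
    (fun i t => X.awake i t ω)
  clock : ∀ i, RegularClock (X.clock (Sum.inl i)) ω
  jumpTime_ne : ∀ i j, i ≠ j → ∀ k l, X.jumpTime i k ω ≠ X.jumpTime j l ω

lemma ae_regular [Countable S] : ∀ᵐ ω ∂μ, X.Regular ω := by
  have h1 : ∀ᵐ ω ∂μ, ∀ i, RegularClock (X.clock (Sum.inl i)) ω :=
    ae_all_iff.2 fun i => X.clocks.ae_regularClock rfl
  have h2 : ∀ᵐ ω ∂μ, ∀ i j, i ≠ j → ∀ k l, X.jumpTime i k ω ≠ X.jumpTime j l ω := by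
    simp_rw [ae_all_iff]
    exact fun i j hij k l => X.clocks.ae_ringTime_ne rfl rfl (by simpa using hij) k l
  filter_upwards [X.path, h1, h2] with ω a b c using ⟨a, b, c⟩

variable {X} {ω : Ω} {o : S} {A : Set S} {n : ℕ}

lemma state_succ_of_active {i : Particle η₀} {k : ℕ} (ha : Alive o A (X.state o A n i k ω))
    (hx : X.ActiveAt i k (X.state o A n i k ω).1 ω) :
    X.state o A n i (k + 1) ω =
      (X.pos i (X.jumpTime i k ω) ω, (X.state o A n i k ω).2 - 1) := by
  rw [state, if_pos ⟨ha, hx⟩]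

lemma state_succ_of_not {i : Particle η₀} {k : ℕ} (h : ¬ (Alive o A (X.state o A n i k ω) ∧
    X.ActiveAt i k (X.state o A n i k ω).1 ω)) :
    X.state o A n i (k + 1) ω = X.state o A n i k ω := by
  rw [state, if_neg h]

lemma state_succ_eq_or_lt (i : Particle η₀) (k : ℕ) :
    X.state o A n i (k + 1) ω = X.state o A n i k ω ∨
      (X.state o A n i (k + 1) ω).2 < (X.state o A n i k ω).2 := by
  by_cases h : Alive o A (X.state o A n i k ω) ∧ X.ActiveAt i k (X.state o A n i k ω).1 ω
  · right
    rw [state_succ_of_active h.1 h.2]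
    exact Nat.sub_lt h.1.2.2 one_pos
  · exact .inl (state_succ_of_not h)

/-- Every change of the record uses up one of its remaining steps, so the record is frozen from the
moment their number is minimal. -/
lemma exists_state_eq (X : ActivatedRandomWalk η₀ P lam μ) (o : S) (A : Set S) (n : ℕ)
    (i : Particle η₀) (ω : Ω) :
    ∃ K, ∀ k ≥ K, X.state o A n i k ω = X.state o A n i K ω := by
  obtain ⟨K, hK⟩ : ∃ K, ∀ k, (X.state o A n i K ω).2 ≤ (X.state o A n i k ω).2 := by
    obtain ⟨_, ⟨K, rfl⟩, hK⟩ := WellFounded.has_min Nat.lt_wfRel.wf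
      (Set.range fun k => (X.state o A n i k ω).2) ⟨_, 0, rfl⟩
    exact ⟨K, fun k => not_lt.1 (hK _ ⟨k, rfl⟩)⟩
  refine ⟨K, fun k hk => ?_⟩
  induction k, hk using Nat.le_induction with
  | base => rfl
  | succ k _ ih =>
    rcases state_succ_eq_or_lt (X := X) (o := o) (A := A) (n := n) (ω := ω) i k with h | h
    · rw [h, ih]
    · rw [ih] at h
      exact absurd (hK (k + 1)) (not_le.2 h)

namespace Regular

lemma jumpTime_lt_iff (h : X.Regular ω) (i : Particle η₀) {k l : ℕ} :
    X.jumpTime i k ω < X.jumpTime i l ω ↔ k < l :=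
  (h.clock i).strictMono.lt_iff_lt

/-- While the record is alive it has missed no jump, so it shows the true position right up to the
next ring. The bound on earlier ring times lets later arguments start before the current ring. -/
lemma pos_eq_of_alive (h : X.Regular ω) (i : Particle η₀) (k : ℕ)
    (ha : Alive o A (X.state o A n i k ω)) :
    ∃ s, s < X.jumpTime i k ω ∧ (∀ l < k, X.jumpTime i l ω ≤ s) ∧
      ∀ t, s ≤ t → t < X.jumpTime i k ω → X.pos i t ω = (X.state o A n i k ω).1 := by
  have key : ∀ k s, s < X.jumpTime i k ω → (∀ l < k, X.jumpTime i l ω ≤ s) →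
      ∀ t, s ≤ t → t < X.jumpTime i k ω → X.pos i t ω = X.pos i s ω := by
    intro k s hs hl t hst ht
    refine h.path.pos_eq i hst fun u hsu hut hu => ?_
    obtain ⟨m, rfl⟩ := (h.clock i).exists_eq_ringTime hu.1
    have hmk : m < k := (h.jumpTime_lt_iff i).1 (hut.trans_lt ht)
    exact absurd hsu (not_lt.2 (hl m hmk))
  induction k with
  | zero =>
    refine ⟨0, (h.clock i).ringTime_pos 0, by simp, fun t h0 ht => ?_⟩
    rw [key 0 0 ((h.clock i).ringTime_pos 0) (by simp) t h0 ht]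
    exact h.path.start i
  | succ k ih =>
    have hlt : X.jumpTime i k ω < X.jumpTime i (k + 1) ω :=
      (h.jumpTime_lt_iff i).2 (Nat.lt_succ_self k)
    have hle : ∀ l < k + 1, X.jumpTime i l ω ≤ X.jumpTime i k ω := fun l hl =>
      (h.clock i).strictMono.monotone (Nat.le_of_lt_succ hl)
    refine ⟨X.jumpTime i k ω, hlt, hle, fun t hst ht => ?_⟩
    rw [key (k + 1) _ hlt hle t hst ht]
    by_cases hact : Alive o A (X.state o A n i k ω) ∧ X.ActiveAt i k (X.state o A n i k ω).1 ω
    · rw [state_succ_of_active hact.1 hact.2]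
    · rw [state_succ_of_not hact] at ha ⊢
      obtain ⟨s, hs, -, hpos⟩ := ih ha
      have hjb : JustBefore (fun t => X.pos i t ω) (X.jumpTime i k ω)
          (X.state o A n i k ω).1 := JustBefore.of_forall hs hpos
      refine (h.path.stay i _ hjb.1 fun hr => hact ⟨ha, hjb.1, ?_⟩).unique hjb
      filter_upwards [hjb.2, hr.2.2] with u hu1 hu2
      -- If the particle had been awake just before, the record would have been updated; so it was
      -- not, and `stay` forbids a move.
      rw [hu1, hu2]

lemma justBefore_of_alive (h : X.Regular ω) (i : Particle η₀) (k : ℕ)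
    (ha : Alive o A (X.state o A n i k ω)) :
    JustBefore (fun t => X.pos i t ω) (X.jumpTime i k ω) (X.state o A n i k ω).1 := by
  obtain ⟨s, hs, -, hpos⟩ := h.pos_eq_of_alive i k ha
  exact JustBefore.of_forall hs hpos

/-- A walk that stops changing its state while alive stays put. -/
lemma pos_eq_of_state_eq (h : X.Regular ω) (i : Particle η₀) {K : ℕ}
    (ha : Alive o A (X.state o A n i K ω))
    (hK : ∀ k ≥ K, X.state o A n i k ω = X.state o A n i K ω) {t : ℝ≥0}
    (ht : X.jumpTime i K ω ≤ t) : X.pos i t ω = (X.state o A n i K ω).1 := by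
  obtain ⟨s, hs, hl, hpos⟩ := h.pos_eq_of_alive i K ha
  rw [← hpos s le_rfl hs]
  refine h.path.pos_eq i (hs.le.trans ht) fun u hsu hut hu => ?_
  obtain ⟨m, rfl⟩ := (h.clock i).exists_eq_ringTime hu.1
  have hmK : K ≤ m := by
    by_contra hcon
    exact absurd hsu (not_lt.2 (hl m (not_le.1 hcon)))
  have ham : Alive o A (X.state o A n i m ω) := by rwa [hK m hmK]
  have hjb := h.justBefore_of_alive i m ham
  have hact : X.ActiveAt i m (X.state o A n i m ω).1 ω := by
    refine ⟨hjb.1, ?_⟩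
    filter_upwards [hjb.2, hu.2.2] with v hv1 hv2
    rw [hv1, hv2]
  have h1 := state_succ_of_active ham hact
  rw [hK m hmK, hK (m + 1) (by omega)] at h1
  have h2 := congrArg Prod.snd h1
  have h3 := ha.2.2
  simp only at h2
  omega

/-- Two particles cannot rest at the same vertex. -/
lemma eq_of_state_eq (h : X.Regular ω) {i j : Particle η₀} {K : ℕ}
    (hi : Alive o A (X.state o A n i K ω)) (hj : Alive o A (X.state o A n j K ω))
    (hiK : ∀ k ≥ K, X.state o A n i k ω = X.state o A n i K ω)
    (hjK : ∀ k ≥ K, X.state o A n j k ω = X.state o A n j K ω)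
    (hij : (X.state o A n i K ω).1 = (X.state o A n j K ω).1) : i = j := by
  by_contra hne
  -- From `t₀` on both particles rest at the same vertex, hence are awake. The next ring of `i` must
  -- then use up a step, contradicting the frozen record.
  set t₀ := max (X.jumpTime i K ω) (X.jumpTime j K ω) with ht₀
  obtain ⟨m, hmK, hm⟩ := (h.clock i).exists_lt_ringTime t₀ K
  have hact : X.ActiveAt i m (X.state o A n i m ω).1 ω := by
    refine JustBefore.of_forall (s := t₀) hm fun u hu _ => ?_
    have h1 := h.pos_eq_of_state_eq i hi hiK ((le_max_left _ _).trans hu)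
    have h2 := h.pos_eq_of_state_eq j hj hjK ((le_max_right _ _).trans hu)
    have hu0 : 0 < u := ((h.clock i).ringTime_pos K).trans_le ((le_max_left _ _).trans hu)
    rw [hiK m hmK, h1, h.path.awake_of_shared (i := i) (j := j) (Ne.symm hne) hu0
      (h2.trans (hij.symm.trans h1.symm))]
  have ham : Alive o A (X.state o A n i m ω) := by rwa [hiK m hmK]
  have h1 := state_succ_of_active ham hact
  rw [hiK m hmK, hiK (m + 1) (by omega)] at h1
  have h2 := congrArg Prod.snd h1
  have h3 := hi.2.2
  simp only at h2
  omega

lemma exists_visit (i : Particle η₀) (hi : i.1 ≠ o) (K : ℕ)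
    (hK : (X.state o A n i K ω).1 = o) : ∃ k, X.jumpTime i k ω ∈ X.visitTimes o ω := by
  induction K with
  | zero => exact absurd hK hi
  | succ k ih =>
    by_cases hact : Alive o A (X.state o A n i k ω) ∧ X.ActiveAt i k (X.state o A n i k ω).1 ω
    · rw [state_succ_of_active hact.1 hact.2] at hK
      exact ⟨k, i, _, hact.1.2.1, hact.2, hK⟩
    · rw [state_succ_of_not hact] at hK
      exact ih hK

/-- A particle not starting at `o` enters its recorded place at `o` by a jump counted in
`visitTimes`, and different particles do so at different times. -/
lemma card_hit_le (h : X.Regular ω) (F : Finset (Particle η₀)) (K : ℕ)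
    (hF : ∀ i ∈ F, (X.state o A n i K ω).1 = o) :
    (F.card : ℕ∞) ≤ η₀ o + (X.visitTimes o ω).encard := by
  classical
  rw [← Finset.card_filter_add_card_filter_not (s := F) (fun i => i.1 = o), Nat.cast_add]
  refine add_le_add ?_ ?_
  · have : (F.filter fun i => i.1 = o) ⊆
        (Finset.univ : Finset (Fin (η₀ o))).map ⟨fun a => ⟨o, a⟩, fun a b hab => by
          simpa using hab⟩ := by
      rintro ⟨x, a⟩ hx
      obtain ⟨-, rfl : x = o⟩ := Finset.mem_filter.1 hx
      exact Finset.mem_map.2 ⟨a, Finset.mem_univ a, rfl⟩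
    have := Finset.card_le_card this
    rw [Finset.card_map, Finset.card_univ, Fintype.card_fin] at this
    exact_mod_cast this
  · have hv : ∀ i, ∃ k, i ∈ F → i.1 ≠ o → X.jumpTime i k ω ∈ X.visitTimes o ω := by
      intro i
      by_cases hi : i ∈ F ∧ i.1 ≠ o
      · obtain ⟨k, hk⟩ := exists_visit i hi.2 K (hF i hi.1)
        exact ⟨k, fun _ _ => hk⟩
      · exact ⟨0, fun h1 h2 => absurd ⟨h1, h2⟩ hi⟩
    choose k hk using hv
    rw [← Set.encard_coe_eq_coe_finsetCard]
    refine Set.encard_le_encard_of_injOn (f := fun i => X.jumpTime i (k i) ω) (fun i hi => ?_)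
      fun i _ j _ hij => ?_
    · obtain ⟨h1, h2⟩ := Finset.mem_filter.1 (Finset.mem_coe.1 hi)
      exact hk i h1 h2
    · by_contra hne
      exact h.jumpTime_ne i j hne _ _ hij

/-- The deterministic heart of the argument. Once all records in `F` are frozen, particles at `o`
are bounded by the visits, stopped particles elsewhere score zero, and the others occupy distinct
vertices of `A`. -/
lemma sum_hitWithin_le [Countable S] [DiscreteMeasurableSpace S] [IsMarkovKernel P]
    (h : X.Regular ω) (ho : o ∈ A) {r : ℕ} (hr : (X.visitTimes o ω).encard < r)
    (F : Finset (Particle η₀)) (n : ℕ) :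
    ∃ K₀, ∀ K ≥ K₀, ∑ i ∈ F, hitWithin P o A (X.state o A n i K ω).2 (X.state o A n i K ω).1 ≤
      η₀ o + r + bigLambda P o A := by
  classical
  choose K₀ hK₀ using fun i => exists_state_eq X o A n i ω
  refine ⟨F.sup K₀, fun K hK => ?_⟩
  have hstab : ∀ i ∈ F, ∀ k ≥ K, X.state o A n i k ω = X.state o A n i K ω := by
    intro i hi k hk
    have hi' : K₀ i ≤ K := (Finset.le_sup hi).trans hK
    rw [hK₀ i k (hi'.trans hk), hK₀ i K hi']
  rw [← Finset.sum_filter_add_sum_filter_not F fun i => (X.state o A n i K ω).1 = o]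
  refine add_le_add ?_ ?_
  · have hcard := h.card_hit_le (o := o) (A := A) (n := n)
      (F.filter fun i => (X.state o A n i K ω).1 = o) K (fun i hi => (Finset.mem_filter.1 hi).2)
    have hcard2 : (F.filter fun i => (X.state o A n i K ω).1 = o).card ≤ η₀ o + r := by
      exact_mod_cast hcard.trans (add_le_add le_rfl hr.le)
    rw [Finset.sum_congr rfl (g := fun _ => (1 : ℝ≥0∞)) fun i hi => by
      rw [(Finset.mem_filter.1 hi).2, hitWithin_self]]
    rw [Finset.sum_const, nsmul_eq_mul, mul_one]
    exact_mod_cast hcard2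
  · set F' := F.filter fun i => ¬ (X.state o A n i K ω).1 = o
    rw [← Finset.sum_filter_add_sum_filter_not F' fun i => Alive o A (X.state o A n i K ω)]
    have hzero : ∑ i ∈ F' with ¬ Alive o A (X.state o A n i K ω),
        hitWithin P o A (X.state o A n i K ω).2 (X.state o A n i K ω).1 = 0 := by
      refine Finset.sum_eq_zero fun i hi => ?_
      obtain ⟨h1, h2⟩ := Finset.mem_filter.1 hi
      have h3 := (Finset.mem_filter.1 h1).2
      by_cases hA : (X.state o A n i K ω).1 ∈ A
      · have : (X.state o A n i K ω).2 = 0 := by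
          by_contra hb
          exact h2 ⟨hA, h3, Nat.pos_of_ne_zero hb⟩
        rw [this, hitWithin_zero_of_ne h3]
      · exact hitWithin_of_notMem _ hA h3
    rw [hzero, add_zero]
    set F'' := F'.filter fun i => Alive o A (X.state o A n i K ω)
    have hF'' : ∀ i ∈ F'', i ∈ F ∧ Alive o A (X.state o A n i K ω) := fun i hi =>
      ⟨(Finset.mem_filter.1 (Finset.mem_filter.1 hi).1).1, (Finset.mem_filter.1 hi).2⟩
    calc ∑ i ∈ F'', hitWithin P o A (X.state o A n i K ω).2 (X.state o A n i K ω).1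
        ≤ ∑ i ∈ F'', hitProb P o A (X.state o A n i K ω).1 :=
          Finset.sum_le_sum fun i _ => hitWithin_le_hitProb ho _ _
      -- Resting particles are at distinct vertices, so a sum over particles becomes a sum over
      -- vertices.
      _ = ∑ x ∈ F''.image fun i => (X.state o A n i K ω).1, hitProb P o A x := by
          rw [Finset.sum_image]
          intro i hi j hj hij
          have hi' := hF'' i hi
          have hj' := hF'' j hj
          exact h.eq_of_state_eq hi'.2 hj'.2 (hstab i hi'.1) (hstab j hj'.1) hij
      _ = ∑ x ∈ F''.image fun i => (X.state o A n i K ω).1, A.indicator (hitProb P o A) x := by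
          refine Finset.sum_congr rfl fun x hx => ?_
          obtain ⟨i, hi, rfl⟩ := Finset.mem_image.1 hx
          rw [Set.indicator_of_mem (hF'' i hi).2.1]
      _ ≤ ∑' x, A.indicator (hitProb P o A) x := ENNReal.sum_le_tsum _
      _ = bigLambda P o A := (tsum_subtype A (hitProb P o A)).symm

end Regular

end ActivatedRandomWalk

end Paths

/-! ### Measurability with respect to the strict past of a ring -/

section Measurability

/-- A dense sequence of times. -/
noncomputable abbrev dseq : ℕ → ℝ≥0 := TopologicalSpace.denseSeq ℝ≥0

lemma exists_dseq_between {a b : ℝ≥0} (h : a < b) : ∃ m, a < dseq m ∧ dseq m < b := by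
  obtain ⟨_, ⟨m, rfl⟩, hm⟩ := (TopologicalSpace.denseRange_denseSeq ℝ≥0).exists_between h
  exact ⟨m, hm⟩

variable {S : Type u} {η₀ : S → ℕ} {lam : ℝ≥0∞}
  [MeasurableSpace S] {P : Kernel S S} {Ω : Type v} {m : MeasurableSpace Ω}
  [mΩ : MeasurableSpace Ω]  {μ : Measure Ω}

namespace ActivatedRandomWalk

/-- The `σ`-algebra of the events up to time `t`, with the null sets added. -/
noncomputable abbrev completedPast (X : ActivatedRandomWalk η₀ P lam μ) (t : ℝ≥0) :
    MeasurableSpace Ω :=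
  eventuallyMeasurableSpace (X.filtration t) (ae μ)

/-- The `σ`-algebra of the events strictly before the `(k+1)`-st ring of the jump clock of `i`,
with the null sets added. -/
noncomputable abbrev jumpPast (X : ActivatedRandomWalk η₀ P lam μ) (i : Particle η₀) (k : ℕ) :
    MeasurableSpace Ω :=
  eventuallyMeasurableSpace (strictPast X.filtration (X.jumpTime i k)) (ae μ)

variable {X : ActivatedRandomWalk η₀ P lam μ}

lemma completedPast_mono {s t : ℝ≥0} (h : s ≤ t) : X.completedPast s ≤ X.completedPast t := by
  rintro G ⟨G', hG', h'⟩
  exact ⟨G', X.filtration.mono h _ hG', h'⟩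

lemma measurableSet_completedPast {s t : ℝ≥0} (h : s ≤ t) {G : Set Ω}
    (hG : MeasurableSet[X.filtration s] G) : MeasurableSet[X.completedPast t] G :=
  ⟨G, X.filtration.mono h _ hG, EventuallyEq.rfl⟩

lemma measurableSet_jumpPast_inter (i : Particle η₀) (k : ℕ) {s : ℝ≥0} {G : Set Ω}
    (hG : MeasurableSet[X.completedPast s] G) :
    MeasurableSet[X.jumpPast i k] (G ∩ {ω | s < X.jumpTime i k ω}) := by
  obtain ⟨G', hG', h⟩ := hG
  refine ⟨G' ∩ {ω | s < X.jumpTime i k ω}, ?_, h.inter EventuallyEq.rfl⟩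
  exact le_sup_right (a := X.filtration 0) _
    (MeasurableSpace.measurableSet_generateFrom ⟨s, G', hG', rfl⟩)

lemma nullMeasurableSet_of_completedPast {t : ℝ≥0} {G : Set Ω}
    (hG : MeasurableSet[X.completedPast t] G) : NullMeasurableSet G μ := by
  obtain ⟨G', hG', h⟩ := hG
  exact ⟨G', X.filtration.le t _ hG', h⟩

lemma nullMeasurableSet_of_forall_lt (i : Particle η₀) (k : ℕ) {B : Set Ω}
    (hB : ∀ q, MeasurableSet[X.completedPast q] ({ω | X.jumpTime i k ω < q} ∩ B)) :
    NullMeasurableSet B μ := by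
  have : B = ⋃ q : ℕ, {ω | X.jumpTime i k ω < q} ∩ B := by
    ext ω
    simp only [Set.mem_iUnion, Set.mem_inter_iff, Set.mem_ofPred_eq, exists_and_right]
    exact ⟨fun h => ⟨exists_nat_gt _, h⟩, fun h => h.2⟩
  rw [this]
  exact NullMeasurableSet.iUnion fun q => nullMeasurableSet_of_completedPast (hB q)

lemma jump_law_of_jumpPast (i : Particle η₀) (k : ℕ) (x y : S) {G : Set Ω}
    (hG : MeasurableSet[X.jumpPast i k] G) :
    μ (G ∩ {ω | X.ActiveAt i k x ω} ∩ {ω | X.pos i (X.jumpTime i k ω) ω = y}) =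
      μ (G ∩ {ω | X.ActiveAt i k x ω}) * P x {y} := by
  obtain ⟨G', hG', h⟩ := hG
  have hlaw := X.jump_law i k x y G' hG'
  have e1 : μ (G ∩ {ω | X.ActiveAt i k x ω}) = μ (G' ∩ {ω | X.ActiveAt i k x ω}) :=
    measure_congr (h.inter EventuallyEq.rfl)
  have e2 : μ (G ∩ {ω | X.ActiveAt i k x ω} ∩ {ω | X.pos i (X.jumpTime i k ω) ω = y}) =
      μ (G' ∩ {ω | X.ActiveAt i k x ω} ∩ {ω | X.pos i (X.jumpTime i k ω) ω = y}) :=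
    measure_congr ((h.inter EventuallyEq.rfl).inter EventuallyEq.rfl)
  rw [e1, e2, Set.inter_assoc]
  exact hlaw

variable [Countable S] {o : S} {A : Set S} {n : ℕ}

/-- Trajectories are regular only almost surely; completing the `σ`-algebras allows events to be
compared on regular outcomes alone. -/
lemma measurableSet_congr_regular {s t : Set Ω}
    (ht : MeasurableSet[eventuallyMeasurableSpace m (ae μ)] t)
    (h : ∀ ω, X.Regular ω → (ω ∈ s ↔ ω ∈ t)) :
    MeasurableSet[eventuallyMeasurableSpace m (ae μ)] s :=
  EventuallyMeasurableSet.congr ht (eventuallyEq_set.2 (X.ae_regular.mono h))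

lemma measurableSet_lt_jumpTime (i : Particle η₀) (k : ℕ) (s : ℝ≥0) :
    MeasurableSet[X.completedPast s] {ω | s < X.jumpTime i k ω} := by
  refine measurableSet_congr_regular (X := X) (t := {ω | X.clock (Sum.inl i) s ω ≤ k})
    (measurableSet_completedPast le_rfl ?_) fun ω hω => (hω.clock i).lt_ringTime_iff
  exact X.clocks.adapted (Sum.inl i) s (MeasurableSet.of_discrete (s := {n | n ≤ k}))

lemma measurableSet_jumpTime_lt (i : Particle η₀) (k : ℕ) (q : ℝ≥0) :
    MeasurableSet[X.completedPast q] {ω | X.jumpTime i k ω < q} := by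
  refine measurableSet_congr_regular (X := X)
    (t := ⋃ m, ⋃ (_ : dseq m < q), {ω | dseq m < X.jumpTime i k ω}ᶜ)
    (MeasurableSet.iUnion fun m => MeasurableSet.iUnion fun hm => MeasurableSet.compl
      (completedPast_mono hm.le _ (measurableSet_lt_jumpTime i k _))) fun ω _ => ?_
  simp only [Set.mem_ofPred_eq, Set.mem_iUnion, Set.mem_compl_iff, not_lt, exists_prop]
  constructor
  · intro h
    obtain ⟨m, h1, h2⟩ := exists_dseq_between h
    exact ⟨m, h2, h1.le⟩
  · rintro ⟨m, h1, h2⟩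
    exact h2.trans_lt h1

lemma measurableSet_state_succ_of_state {B : Set Ω} (i : Particle η₀)
    (k : ℕ)
    (hact : ∀ x, MeasurableSet[m] (B ∩ {ω | X.ActiveAt i k x ω}))
    (hpos : ∀ y, MeasurableSet[m] (B ∩ {ω | X.pos i (X.jumpTime i k ω) ω = y}))
    (hst : ∀ c, MeasurableSet[m] (B ∩ {ω | X.state o A n i k ω = c})) (c : S × ℕ) :
    MeasurableSet[m] (B ∩ {ω | X.state o A n i (k + 1) ω = c}) := by
  have h : B ∩ {ω | X.state o A n i (k + 1) ω = c} = ⋃ c' : S × ℕ,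
      (B ∩ {ω | X.state o A n i k ω = c'}) ∩
        (({_ω | Alive o A c' ∧ c'.2 - 1 = c.2} ∩ (B ∩ {ω | X.ActiveAt i k c'.1 ω}) ∩
          (B ∩ {ω | X.pos i (X.jumpTime i k ω) ω = c.1})) ∪
        ({_ω | c' = c} ∩
          ({_ω | ¬ Alive o A c'} ∪ (B ∩ {ω | X.ActiveAt i k c'.1 ω})ᶜ))) := by
    ext ω
    simp only [Set.mem_inter_iff, Set.mem_ofPred_eq, Set.mem_iUnion, Set.mem_union,
      Set.mem_compl_iff]
    constructor
    · rintro ⟨hb, rfl⟩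
      refine ⟨_, ⟨hb, rfl⟩, ?_⟩
      by_cases hx : Alive o A (X.state o A n i k ω) ∧ X.ActiveAt i k (X.state o A n i k ω).1 ω
      · left
        rw [state_succ_of_active hx.1 hx.2]
        exact ⟨⟨⟨hx.1, rfl⟩, hb, hx.2⟩, hb, rfl⟩
      · right
        rw [state_succ_of_not hx]
        tauto
    · rintro ⟨c', ⟨hb, rfl⟩, ⟨⟨⟨h1, h2⟩, -, h3⟩, -, h4⟩ | ⟨rfl, h1⟩⟩
      · refine ⟨hb, ?_⟩
        rw [state_succ_of_active h1 h3, h2, h4]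
      · refine ⟨hb, state_succ_of_not ?_⟩
        tauto
  rw [h]
  exact MeasurableSet.iUnion fun c' => (hst c').inter
    ((((MeasurableSet.const _).inter (hact _)).inter (hpos _)).union
      ((MeasurableSet.const _).inter ((MeasurableSet.const _).union (hact _).compl)))

/-- A dense time fits strictly between the two rings. What is known by that time belongs to the
strict past of the later ring. -/
lemma measurableSet_jumpPast_of_lt (i j : Particle η₀) (k l : ℕ) {B : Set Ω}
    (hB : ∀ q, MeasurableSet[X.completedPast q] ({ω | X.jumpTime j l ω < q} ∩ B)) :
    MeasurableSet[X.jumpPast i k] ({ω | X.jumpTime j l ω < X.jumpTime i k ω} ∩ B) := by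
  refine measurableSet_congr_regular (X := X)
    (MeasurableSet.iUnion fun m => measurableSet_jumpPast_inter i k (hB (dseq m))) fun ω _ => ?_
  simp only [Set.mem_inter_iff, Set.mem_ofPred_eq, Set.mem_iUnion]
  constructor
  · rintro ⟨h1, h2⟩
    obtain ⟨m, h3, h4⟩ := exists_dseq_between h1
    exact ⟨m, ⟨h3, h2⟩, h4⟩
  · rintro ⟨m, ⟨h3, h2⟩, h4⟩
    exact ⟨h3.trans h4, h2⟩

lemma nullMeasurableSet_of_jumpPast {i : Particle η₀} {k : ℕ} {G : Set Ω}
    (hG : MeasurableSet[X.jumpPast i k] G) : NullMeasurableSet G μ := by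
  obtain ⟨G', hG', h⟩ := hG
  have hle : strictPast X.filtration (X.jumpTime i k) ≤
      eventuallyMeasurableSpace mΩ (ae μ) := by
    refine sup_le ((X.filtration.le 0).trans le_eventuallyMeasurableSpace)
      (MeasurableSpace.generateFrom_le ?_)
    rintro _ ⟨s, B, hB, rfl⟩
    exact NullMeasurableSet.inter (X.filtration.le s _ hB).nullMeasurableSet
      (nullMeasurableSet_of_completedPast (measurableSet_lt_jumpTime i k s))
  exact NullMeasurableSet.congr (hle _ hG') h.symm

variable [DiscreteMeasurableSpace S]

/-- The left limit exists, so it can be read off from dense times just before the ring. -/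
lemma measurableSet_activeAt (i : Particle η₀) (k : ℕ) (x : S) (q : ℝ≥0) :
    MeasurableSet[X.completedPast q] {ω | X.jumpTime i k ω < q ∧ X.ActiveAt i k x ω} := by
  refine measurableSet_congr_regular (X := X)
    (t := {ω | X.jumpTime i k ω < q} ∩ ⋃ m, ⋃ (_ : dseq m < q), {ω | dseq m < X.jumpTime i k ω} ∩
      ⋂ m', ⋂ (_ : dseq m < dseq m' ∧ dseq m' < q), ({ω | dseq m' < X.jumpTime i k ω}ᶜ ∪
        ({ω | X.pos i (dseq m') ω = x} ∩ {ω | X.awake i (dseq m') ω = true})))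
    ((measurableSet_jumpTime_lt i k q).inter (MeasurableSet.iUnion fun m =>
      MeasurableSet.iUnion fun hm => MeasurableSet.inter
        (completedPast_mono hm.le _ (measurableSet_lt_jumpTime i k _))
        (MeasurableSet.iInter fun m' => MeasurableSet.iInter fun hm' => MeasurableSet.union
          (completedPast_mono hm'.2.le _ (measurableSet_lt_jumpTime i k _)).compl
          (MeasurableSet.inter
            (measurableSet_completedPast hm'.2.le
              (X.pos_adapted i _ (MeasurableSet.of_discrete (s := {x}))))
            (measurableSet_completedPast hm'.2.le
              (X.awake_adapted i _ (MeasurableSet.of_discrete (s := {true})))))))) fun ω hω => ?_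
  simp only [Set.mem_ofPred_eq, Set.mem_inter_iff, Set.mem_iUnion, Set.mem_iInter, Set.mem_union,
    Set.mem_compl_iff, exists_prop, and_congr_right_iff]
  intro hq
  constructor
  · intro hact
    obtain ⟨l, hl, hsub⟩ := (mem_nhdsLT_iff_exists_Ioo_subset' hact.1).1 hact.2
    obtain ⟨m, h1, h2⟩ := exists_dseq_between (Set.mem_Iio.1 hl)
    refine ⟨m, h2.trans hq, h2, fun m' hm' => ?_⟩
    by_cases h' : dseq m' < X.jumpTime i k ω
    · right
      have : (X.pos i (dseq m') ω, X.awake i (dseq m') ω) = (x, true) :=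
        hsub ⟨h1.trans hm'.1, h'⟩
      exact ⟨congrArg Prod.fst this, congrArg Prod.snd this⟩
    · exact .inl h'
  · rintro ⟨m, -, hm, h⟩
    obtain ⟨x', a', hjb⟩ := hω.path.left_lim i (X.jumpTime i k ω) (pos_of_gt hm)
    obtain ⟨l, hl, hsub⟩ := (mem_nhdsLT_iff_exists_Ioo_subset' hjb.1).1 hjb.2
    obtain ⟨m', h1, h2⟩ := exists_dseq_between (max_lt (Set.mem_Iio.1 hl) hm)
    have e1 : (X.pos i (dseq m') ω, X.awake i (dseq m') ω) = (x', a') :=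
      hsub ⟨(le_max_left _ _).trans_lt h1, h2⟩
    obtain h3 | h3 := h m' ⟨(le_max_right _ _).trans_lt h1, h2.trans hq⟩
    · exact absurd h2 h3
    · rw [h3.1, h3.2] at e1
      rw [ActiveAt, e1]
      exact hjb

/-- By right-continuity the position is read off from dense times just after the ring. These must be
less than `q`, so the ring must precede `q` strictly; the filtration need not be right-continuous.
-/
lemma measurableSet_pos_jumpTime (i : Particle η₀) (k : ℕ) (y : S) (q : ℝ≥0) :
    MeasurableSet[X.completedPast q]
      {ω | X.jumpTime i k ω < q ∧ X.pos i (X.jumpTime i k ω) ω = y} := by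
  refine measurableSet_congr_regular (X := X)
    (t := {ω | X.jumpTime i k ω < q} ∩ ⋃ m, ⋃ (_ : dseq m < q), {ω | X.jumpTime i k ω < dseq m} ∩
      ⋂ m', ⋂ (_ : dseq m' < dseq m), ({ω | X.jumpTime i k ω < dseq m'}ᶜ ∪
        {ω | X.pos i (dseq m') ω = y}))
    ((measurableSet_jumpTime_lt i k q).inter (MeasurableSet.iUnion fun m =>
      MeasurableSet.iUnion fun hm => MeasurableSet.inter
        (completedPast_mono hm.le _ (measurableSet_jumpTime_lt i k _))
        (MeasurableSet.iInter fun m' => MeasurableSet.iInter fun hm' => MeasurableSet.union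
          (completedPast_mono (hm'.trans hm).le _ (measurableSet_jumpTime_lt i k _)).compl
            (measurableSet_completedPast (hm'.trans hm).le
              (X.pos_adapted i _ (MeasurableSet.of_discrete (s := {y}))))))) fun ω hω => ?_
  simp only [Set.mem_ofPred_eq, Set.mem_inter_iff, Set.mem_iUnion, Set.mem_iInter, Set.mem_union,
    Set.mem_compl_iff, exists_prop, and_congr_right_iff]
  intro hq
  obtain ⟨u, hu, hsub⟩ := mem_nhdsGT_iff_exists_Ioo_subset.1
    (hω.path.right_cont i (X.jumpTime i k ω))
  constructor
  · intro hy
    obtain ⟨m, h1, h2⟩ := exists_dseq_between (lt_min (Set.mem_Ioi.1 hu) hq)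
    refine ⟨m, h2.trans_le (min_le_right _ _), h1, fun m' hm' => ?_⟩
    by_cases h' : X.jumpTime i k ω < dseq m'
    · right
      rw [← hy]
      exact (hsub ⟨h', hm'.trans (h2.trans_le (min_le_left _ _))⟩).1
    · exact .inl h'
  · rintro ⟨m, -, hm, h⟩
    obtain ⟨m', h1, h2⟩ := exists_dseq_between (lt_min (Set.mem_Ioi.1 hu) hm)
    obtain h3 | h3 := h m' (h2.trans_le (min_le_right _ _))
    · exact absurd h1 h3
    · rw [← h3]
      exact (hsub ⟨h1, h2.trans_le (min_le_left _ _)⟩).1.symm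

lemma measurableSet_state_and_succ (i : Particle η₀) (k : ℕ) (q : ℝ≥0) :
    (∀ c, MeasurableSet[X.completedPast q]
      ({ω | X.jumpTime i k ω < q} ∩ {ω | X.state o A n i k ω = c})) ∧
    (∀ c, MeasurableSet[X.completedPast q]
      ({ω | X.jumpTime i k ω < q} ∩ {ω | X.state o A n i (k + 1) ω = c})) := by
  have step : ∀ k, (∀ c, MeasurableSet[X.completedPast q]
      ({ω | X.jumpTime i k ω < q} ∩ {ω | X.state o A n i k ω = c})) →
    (∀ c, MeasurableSet[X.completedPast q]
      ({ω | X.jumpTime i k ω < q} ∩ {ω | X.state o A n i (k + 1) ω = c})) := fun k hk =>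
    measurableSet_state_succ_of_state i k
      (fun x => measurableSet_activeAt i k x q) (fun y => measurableSet_pos_jumpTime i k y q) hk
  suffices h : ∀ c, MeasurableSet[X.completedPast q]
      ({ω | X.jumpTime i k ω < q} ∩ {ω | X.state o A n i k ω = c}) from ⟨h, step k h⟩
  induction k with
  | zero => exact fun c => (measurableSet_jumpTime_lt i 0 q).inter (.const ((i.1, n) = c))
  | succ k ih =>
    refine fun c => measurableSet_congr_regular (X := X)
      ((measurableSet_jumpTime_lt i (k + 1) q).inter (step k ih c)) fun ω hω => ?_
    simp only [Set.mem_inter_iff, Set.mem_ofPred_eq]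
    have := (hω.jumpTime_lt_iff i).2 (Nat.lt_succ_self k)
    constructor
    · exact fun h => ⟨h.1, this.trans h.1, h.2⟩
    · exact fun h => ⟨h.1, h.2.2⟩

lemma measurableSet_jumpPast_state (i : Particle η₀) (k : ℕ) (c : S × ℕ) :
    MeasurableSet[X.jumpPast i k] {ω | X.state o A n i k ω = c} := by
  cases k with
  | zero => exact MeasurableSet.const ((i.1, n) = c)
  | succ k =>
    refine measurableSet_congr_regular (X := X) (measurableSet_jumpPast_of_lt i i (k + 1) k
      fun q => (measurableSet_state_and_succ (o := o) (A := A) (n := n) i k q).2 c) fun ω hω => ?_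
    have := (hω.jumpTime_lt_iff i).2 (Nat.lt_succ_self k)
    simp [this]

end ActivatedRandomWalk

end Measurability

/-! ### The score martingale, orthogonality and concentration -/

section Martingale

variable {S : Type u} [MeasurableSpace S] {η₀ : S → ℕ}
  {lam : ℝ≥0∞} {P : Kernel S S} {Ω : Type v} [mΩ : MeasurableSpace Ω] {μ : Measure Ω}

namespace ActivatedRandomWalk

/-- The conditional probability that the stopped walk of the particle `i` hits `o`, after `k` rings
of its jump clock. -/
noncomputable def score (X : ActivatedRandomWalk η₀ P lam μ) (o : S) (A : Set S) (n : ℕ)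
    (i : Particle η₀) (k : ℕ) (ω : Ω) : ℝ≥0∞ :=
  hitWithin P o A (X.state o A n i k ω).2 (X.state o A n i k ω).1

/-- The change of the score of the particle `i` at the `(k+1)`-st ring of its jump clock. -/
noncomputable def scoreIncr (X : ActivatedRandomWalk η₀ P lam μ) (o : S) (A : Set S) (n : ℕ)
    (i : Particle η₀) (k : ℕ) (ω : Ω) : ℝ :=
  (X.score o A n i (k + 1) ω).toReal - (X.score o A n i k ω).toReal

variable {X : ActivatedRandomWalk η₀ P lam μ} {o : S} {A : Set S} {n : ℕ}

lemma integrable_of_abs_le [IsProbabilityMeasure μ] {f : Ω → ℝ} (hf : AEMeasurable f μ)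
    {C : ℝ} (h : ∀ ω, |f ω| ≤ C) :
    Integrable f μ :=
  Integrable.of_bound hf.aestronglyMeasurable C (.of_forall h)

lemma score_sub_eq_sum (i : Particle η₀) (K : ℕ) (ω : Ω) :
    (X.score o A n i K ω).toReal - (hitWithin P o A n i.1).toReal =
      ∑ k ∈ Finset.range K, X.scoreIncr o A n i k ω :=
  (Finset.sum_range_sub (fun k => (X.score o A n i k ω).toReal) K).symm

lemma score_le_one [IsMarkovKernel P] (i : Particle η₀) (k : ℕ) (ω : Ω) : X.score o A n i k ω ≤ 1 :=
  hitWithin_le_one _ _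

lemma score_toReal_mem [IsMarkovKernel P] (i : Particle η₀) (k : ℕ) (ω : Ω) :
    0 ≤ (X.score o A n i k ω).toReal ∧ (X.score o A n i k ω).toReal ≤ 1 :=
  ⟨ENNReal.toReal_nonneg,
    ENNReal.toReal_le_of_le_ofReal zero_le_one (by simpa using score_le_one i k ω)⟩

lemma abs_scoreIncr_le [IsMarkovKernel P] (i : Particle η₀) (k : ℕ) (ω : Ω) :
    |X.scoreIncr o A n i k ω| ≤ 1 := by
  have h1 := score_toReal_mem (X := X) (o := o) (A := A) (n := n) i k ω
  have h2 := score_toReal_mem (X := X) (o := o) (A := A) (n := n) i (k + 1) ω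
  rw [scoreIncr, abs_le]
  constructor <;> linarith

variable [Countable S] [DiscreteMeasurableSpace S]

lemma nullMeasurableSet_state (i : Particle η₀) (k : ℕ) (c : S × ℕ) :
    NullMeasurableSet {ω | X.state o A n i k ω = c} μ :=
  nullMeasurableSet_of_jumpPast (measurableSet_jumpPast_state i k c)

lemma aemeasurable_state (i : Particle η₀) (k : ℕ) : AEMeasurable (X.state o A n i k) μ := by
  refine NullMeasurable.aemeasurable fun s _ => ?_
  have : X.state o A n i k ⁻¹' s = ⋃ c ∈ s, {ω | X.state o A n i k ω = c} := by
    ext ω; simp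
  rw [this]
  exact NullMeasurableSet.biUnion s.to_countable fun c _ => nullMeasurableSet_state i k c

lemma aemeasurable_score (i : Particle η₀) (k : ℕ) : AEMeasurable (X.score o A n i k) μ :=
  (Measurable.of_discrete (f := fun c : S × ℕ => hitWithin P o A c.2 c.1)).comp_aemeasurable
    (aemeasurable_state i k)

lemma aemeasurable_score_toReal (i : Particle η₀) (k : ℕ) :
    AEMeasurable (fun ω => (X.score o A n i k ω).toReal) μ :=
  (aemeasurable_score i k).ennreal_toReal

lemma aemeasurable_scoreIncr (i : Particle η₀) (k : ℕ) :
    AEMeasurable (X.scoreIncr o A n i k) μ :=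
  (aemeasurable_score_toReal i (k + 1)).sub (aemeasurable_score_toReal i k)

/-- With the record fixed at `c`, it changes only if `c` is alive and the particle is awake. Then
the new vertex has law `P c.1`, and the recursion for `hitWithin` says that averaging over it
returns the old score. -/
lemma setLIntegral_score_succ_of_state (i : Particle η₀) (k : ℕ) (c : S × ℕ) {G : Set Ω}
    (hG : MeasurableSet[X.jumpPast i k] G) (hGc : ∀ ω ∈ G, X.state o A n i k ω = c) :
    ∫⁻ ω in G, X.score o A n i (k + 1) ω ∂μ = ∫⁻ ω in G, X.score o A n i k ω ∂μ := by
  have hGn := nullMeasurableSet_of_jumpPast hG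
  have hcongr : ∀ H : Set Ω, NullMeasurableSet H μ →
      (∀ ω ∈ H, X.state o A n i (k + 1) ω = X.state o A n i k ω) →
      ∫⁻ ω in H, X.score o A n i (k + 1) ω ∂μ = ∫⁻ ω in H, X.score o A n i k ω ∂μ := by
    intro H hH h
    refine lintegral_congr_ae ((ae_restrict_iff'₀ hH).2 (.of_forall fun ω hω => ?_))
    simp only [score, h ω hω]
  by_cases hc : Alive o A c
  · have hact : NullMeasurableSet {ω | X.ActiveAt i k c.1 ω} μ :=
      nullMeasurableSet_of_forall_lt i k fun q => measurableSet_activeAt i k c.1 q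
    have hpos : ∀ y, NullMeasurableSet {ω | X.pos i (X.jumpTime i k ω) ω = y} μ := fun y =>
      nullMeasurableSet_of_forall_lt i k fun q => measurableSet_pos_jumpTime i k y q
    rw [← Measure.restrict_inter_add_sdiff₀ G hact, lintegral_add_measure, lintegral_add_measure]
    congr 1
    · set H := G ∩ {ω | X.ActiveAt i k c.1 ω} with hH
      have hHn : NullMeasurableSet H μ := hGn.inter hact
      have hpart : H = ⋃ y, H ∩ {ω | X.pos i (X.jumpTime i k ω) ω = y} := by
        ext ω; simp
      have hleft : ∫⁻ ω in H, X.score o A n i (k + 1) ω ∂μ =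
          ∑' y, hitWithin P o A (c.2 - 1) y * (μ H * P c.1 {y}) := by
        conv_lhs => rw [hpart]
        rw [lintegral_iUnion₀ (fun y => hHn.inter (hpos y))]
        · refine tsum_congr fun y => ?_
          rw [← jump_law_of_jumpPast i k c.1 y hG, ← setLIntegral_const]
          refine lintegral_congr_ae
            ((ae_restrict_iff'₀ (hHn.inter (hpos y))).2 (.of_forall fun ω hω => ?_))
          have hst := hGc ω hω.1.1
          have h1 := state_succ_of_active (X := X) (o := o) (A := A) (n := n) (ω := ω) (i := i)
            (k := k) (by rwa [hst]) (by rw [hst]; exact hω.1.2)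
          have h2 : X.pos i (X.jumpTime i k ω) ω = y := hω.2
          simp only [score, h1, h2, hst]
        · intro y y' hyy'
          refine Disjoint.aedisjoint (Set.disjoint_left.2 fun ω h1 h2 => hyy' ?_)
          exact h1.2.symm.trans h2.2
      have hright : ∫⁻ ω in H, X.score o A n i k ω ∂μ = hitWithin P o A c.2 c.1 * μ H := by
        rw [← setLIntegral_const]
        refine lintegral_congr_ae ((ae_restrict_iff'₀ hHn).2 (.of_forall fun ω hω => ?_))
        simp only [score, hGc ω hω.1]
      -- Being alive guarantees a step left, so the budget is a successor and the recursion applies.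
      obtain ⟨b, hb⟩ := Nat.exists_eq_add_one_of_ne_zero hc.2.2.ne'
      rw [hleft, hright, hb, hitWithin_succ hc.1 hc.2.1, lintegral_countable', Nat.add_sub_cancel,
        ← ENNReal.tsum_mul_right]
      refine tsum_congr fun y => ?_
      ring
    · refine hcongr _ (hGn.diff hact) fun ω hω => state_succ_of_not fun h => hω.2 ?_
      rw [hGc ω hω.1] at h
      exact h.2
  · refine hcongr G hGn fun ω hω => state_succ_of_not fun h => hc ?_
    rw [← hGc ω hω]
    exact h.1

/-- The score of a particle is a martingale. -/
lemma setLIntegral_score_succ (i : Particle η₀) (k : ℕ) {G : Set Ω}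
    (hG : MeasurableSet[X.jumpPast i k] G) :
    ∫⁻ ω in G, X.score o A n i (k + 1) ω ∂μ = ∫⁻ ω in G, X.score o A n i k ω ∂μ := by
  have hpart : G = ⋃ c, G ∩ {ω | X.state o A n i k ω = c} := by
    ext ω; simp
  have hm : ∀ c, MeasurableSet[X.jumpPast i k] (G ∩ {ω | X.state o A n i k ω = c}) := fun c =>
    hG.inter (measurableSet_jumpPast_state i k c)
  have hd : Pairwise (Function.onFun (AEDisjoint μ)
      fun c => G ∩ {ω | X.state o A n i k ω = c}) := by
    intro c c' hcc'
    refine Disjoint.aedisjoint (Set.disjoint_left.2 fun ω h1 h2 => hcc' ?_)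
    exact h1.2.symm.trans h2.2
  rw [hpart, lintegral_iUnion₀ (fun c => nullMeasurableSet_of_jumpPast (hm c)) hd,
    lintegral_iUnion₀ (fun c => nullMeasurableSet_of_jumpPast (hm c)) hd]
  exact tsum_congr fun c => setLIntegral_score_succ_of_state i k c (hm c) fun ω hω => hω.2

lemma lintegral_score [IsProbabilityMeasure μ] (i : Particle η₀) (k : ℕ) :
    ∫⁻ ω, X.score o A n i k ω ∂μ = hitWithin P o A n i.1 := by
  induction k with
  | zero => simp [score, state]
  | succ k ih =>
    have := setLIntegral_score_succ (X := X) (o := o) (A := A) (n := n) i k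
      (@MeasurableSet.univ _ (X.jumpPast i k))
    rwa [Measure.restrict_univ, ih] at this

variable [IsMarkovKernel P] [IsProbabilityMeasure μ]

lemma integral_score (i : Particle η₀) (k : ℕ) :
    ∫ ω, (X.score o A n i k ω).toReal ∂μ = (hitWithin P o A n i.1).toReal := by
  rw [integral_toReal (aemeasurable_score i k)
    (.of_forall fun ω => (score_le_one i k ω).trans_lt ENNReal.one_lt_top), lintegral_score]

lemma integrable_scoreIncr_mul (i j : Particle η₀) (k l : ℕ) :
    Integrable (fun ω => X.scoreIncr o A n i k ω * X.scoreIncr o A n j l ω) μ :=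
  integrable_of_abs_le ((aemeasurable_scoreIncr i k).mul (aemeasurable_scoreIncr j l)) (C := 1)
    fun ω => by
      rw [abs_mul]
      exact mul_le_one₀ (abs_scoreIncr_le i k ω) (abs_nonneg _) (abs_scoreIncr_le j l ω)

lemma setIntegral_scoreIncr (i : Particle η₀) (k : ℕ) {G : Set Ω}
    (hG : MeasurableSet[X.jumpPast i k] G) : ∫ ω in G, X.scoreIncr o A n i k ω ∂μ = 0 := by
  have hint : ∀ k, Integrable (fun ω => (X.score o A n i k ω).toReal) (μ.restrict G) := fun k =>
    (integrable_of_abs_le (aemeasurable_score_toReal i k) (C := 1) fun ω => by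
      have := score_toReal_mem (X := X) (o := o) (A := A) (n := n) i k ω
      rw [abs_le]; constructor <;> linarith).integrableOn
  have hval : ∀ k, ∫ ω in G, (X.score o A n i k ω).toReal ∂μ =
      (∫⁻ ω in G, X.score o A n i k ω ∂μ).toReal := fun k =>
    integral_toReal (aemeasurable_score i k).restrict
      (.of_forall fun ω => (score_le_one i k ω).trans_lt ENNReal.one_lt_top)
  simp only [scoreIncr]
  rw [integral_sub (hint _) (hint _), hval, hval, setLIntegral_score_succ i k hG, sub_self]

/-- Split according to the records of `j` before and after its ring. Each piece lies in the strict
past of the later ring of `i`; on it the increment of `j` is constant and that of `i` integrates to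
zero. -/
lemma setIntegral_scoreIncr_mul (i j : Particle η₀) (k l : ℕ) :
    ∫ ω in {ω | X.jumpTime j l ω < X.jumpTime i k ω},
      X.scoreIncr o A n i k ω * X.scoreIncr o A n j l ω ∂μ = 0 := by
  set E := {ω | X.jumpTime j l ω < X.jumpTime i k ω}
  set B : (S × ℕ) × (S × ℕ) → Set Ω := fun c =>
    (E ∩ {ω | X.state o A n j l ω = c.1}) ∩ (E ∩ {ω | X.state o A n j (l + 1) ω = c.2})
  have hB : ∀ c, MeasurableSet[X.jumpPast i k] (B c) := fun c =>
    (measurableSet_jumpPast_of_lt i j k l fun q =>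
      (measurableSet_state_and_succ j l q).1 c.1).inter
    (measurableSet_jumpPast_of_lt i j k l fun q => (measurableSet_state_and_succ j l q).2 c.2)
  have hpart : E = ⋃ c, B c := by
    ext ω; simp [B]
  have hd : Pairwise (Function.onFun (AEDisjoint μ) B) := by
    intro c c' hcc'
    refine Disjoint.aedisjoint (Set.disjoint_left.2 fun ω h1 h2 => hcc' ?_)
    exact Prod.ext (h1.1.2.symm.trans h2.1.2) (h1.2.2.symm.trans h2.2.2)
  rw [hpart, integral_iUnion_ae (fun c => nullMeasurableSet_of_jumpPast (hB c)) hd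
    (integrable_scoreIncr_mul i j k l).integrableOn]
  refine (tsum_congr fun c => ?_).trans tsum_zero
  set d : ℝ := (hitWithin P o A c.2.2 c.2.1).toReal - (hitWithin P o A c.1.2 c.1.1).toReal
  have : ∫ ω in B c, X.scoreIncr o A n i k ω * X.scoreIncr o A n j l ω ∂μ =
      ∫ ω in B c, X.scoreIncr o A n i k ω * d ∂μ := by
    refine integral_congr_ae ((ae_restrict_iff'₀ (nullMeasurableSet_of_jumpPast (hB c))).2
      (.of_forall fun ω hω => ?_))
    have h1 : X.state o A n j l ω = c.1 := hω.1.2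
    have h2 : X.state o A n j (l + 1) ω = c.2 := hω.2.2
    have : X.scoreIncr o A n j l ω = d := by simp only [scoreIncr, score, h1, h2, d]
    simp only [this]
  rw [this, integral_mul_const, setIntegral_scoreIncr i k (hB c), zero_mul]

lemma integral_scoreIncr_mul {i j : Particle η₀} (hij : i ≠ j) (k l : ℕ) :
    ∫ ω, X.scoreIncr o A n i k ω * X.scoreIncr o A n j l ω ∂μ = 0 := by
  set E := {ω | X.jumpTime j l ω < X.jumpTime i k ω} with hE
  have hEn : NullMeasurableSet E μ := by
    have := measurableSet_jumpPast_of_lt (X := X) i j k l (B := Set.univ) fun q => by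
      simpa using measurableSet_jumpTime_lt j l q
    rw [Set.inter_univ] at this
    exact nullMeasurableSet_of_jumpPast this
  rw [← integral_add_compl₀ hEn (integrable_scoreIncr_mul i j k l),
    setIntegral_scoreIncr_mul i j k l, zero_add]
  -- Rings of different particles never coincide, so the complement is the opposite strict order and
  -- the roles of `i` and `j` can be exchanged.
  have hcompl : (Eᶜ : Set Ω) =ᵐ[μ] {ω | X.jumpTime i k ω < X.jumpTime j l ω} := by
    refine eventuallyEq_set.2 (X.ae_regular.mono fun ω hω => ?_)
    simp only [hE, Set.mem_compl_iff, Set.mem_ofPred_eq, not_lt]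
    exact (hω.jumpTime_ne i j hij k l).le_iff_lt
  rw [setIntegral_congr_set hcompl]
  simp_rw [mul_comm (X.scoreIncr o A n i k _)]
  exact setIntegral_scoreIncr_mul j i l k

lemma integral_score_sub_mul {i j : Particle η₀} (hij : i ≠ j) (K : ℕ) :
    ∫ ω, ((X.score o A n i K ω).toReal - (hitWithin P o A n i.1).toReal) *
      ((X.score o A n j K ω).toReal - (hitWithin P o A n j.1).toReal) ∂μ = 0 := by
  simp_rw [score_sub_eq_sum, Finset.sum_mul_sum]
  rw [integral_finsetSum _ fun k _ => integrable_finsetSum _ fun l _ =>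
    integrable_scoreIncr_mul i j k l]
  refine Finset.sum_eq_zero fun k _ => ?_
  rw [integral_finsetSum _ fun l _ => integrable_scoreIncr_mul i j k l]
  exact Finset.sum_eq_zero fun l _ => integral_scoreIncr_mul hij k l

/-- A variable in `[0, 1]` is at least its square, so its variance is at most its mean. -/
lemma integral_score_sub_sq_le (i : Particle η₀) (K : ℕ) :
    ∫ ω, ((X.score o A n i K ω).toReal - (hitWithin P o A n i.1).toReal) *
      ((X.score o A n i K ω).toReal - (hitWithin P o A n i.1).toReal) ∂μ ≤
        (hitWithin P o A n i.1).toReal := by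
  set a := (hitWithin P o A n i.1).toReal
  have hint : Integrable (fun ω => (X.score o A n i K ω).toReal) μ :=
    integrable_of_abs_le (aemeasurable_score_toReal i K) (C := 1) fun ω => by
      have := score_toReal_mem (X := X) (o := o) (A := A) (n := n) i K ω
      rw [abs_le]; constructor <;> linarith
  have hmean : ∫ ω, (X.score o A n i K ω).toReal ∂μ = a := integral_score i K
  calc ∫ ω, ((X.score o A n i K ω).toReal - a) * ((X.score o A n i K ω).toReal - a) ∂μ
      ≤ ∫ ω, ((1 - 2 * a) * (X.score o A n i K ω).toReal + a ^ 2) ∂μ := by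
        refine integral_mono_of_nonneg (.of_forall fun ω => mul_self_nonneg _)
          ((hint.const_mul _).add (integrable_const _)) (.of_forall fun ω => ?_)
        have := score_toReal_mem (X := X) (o := o) (A := A) (n := n) i K ω
        simp only
        nlinarith
    _ = (1 - 2 * a) * a + a ^ 2 := by
        rw [integral_add (hint.const_mul _) (integrable_const _), integral_const_mul, hmean]
        simp
    _ ≤ a := by nlinarith [sq_nonneg a]

lemma integrable_score_sub_mul (i j : Particle η₀) (K : ℕ) :
    Integrable (fun ω => ((X.score o A n i K ω).toReal - (hitWithin P o A n i.1).toReal) *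
      ((X.score o A n j K ω).toReal - (hitWithin P o A n j.1).toReal)) μ := by
  simp_rw [score_sub_eq_sum, Finset.sum_mul_sum]
  exact integrable_finsetSum _ fun k _ => integrable_finsetSum _ fun l _ =>
    integrable_scoreIncr_mul i j k l

/-- All cross terms vanish by orthogonality. Each particle is stopped after `K` of its own rings,
not at a common time, and pairwise orthogonality is all that is needed. -/
lemma integral_sum_score_sub_sq_le (F : Finset (Particle η₀)) (K : ℕ) :
    ∫ ω, (∑ i ∈ F, ((X.score o A n i K ω).toReal - (hitWithin P o A n i.1).toReal)) ^ 2 ∂μ ≤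
      ∑ i ∈ F, (hitWithin P o A n i.1).toReal := by
  classical
  simp_rw [sq, Finset.sum_mul_sum]
  rw [integral_finsetSum _ fun i _ => integrable_finsetSum _ fun j _ =>
    integrable_score_sub_mul i j K]
  refine Finset.sum_le_sum fun i hi => ?_
  rw [integral_finsetSum _ fun j _ => integrable_score_sub_mul i j K,
    Finset.sum_eq_single_of_mem i hi fun j _ hj => integral_score_sub_mul hj.symm K]
  exact integral_score_sub_sq_le i K

/-- The sum of the scores is concentrated. -/
lemma measure_sum_score_le (F : Finset (Particle η₀)) (K : ℕ) {c : ℝ}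
    (hc : c < ∑ i ∈ F, (hitWithin P o A n i.1).toReal) :
    μ {ω | ∑ i ∈ F, (X.score o A n i K ω).toReal ≤ c} ≤
      ENNReal.ofReal ((∑ i ∈ F, (hitWithin P o A n i.1).toReal) /
        ((∑ i ∈ F, (hitWithin P o A n i.1).toReal) - c) ^ 2) := by
  set a := ∑ i ∈ F, (hitWithin P o A n i.1).toReal with ha
  set f : Ω → ℝ := fun ω =>
    (∑ i ∈ F, ((X.score o A n i K ω).toReal - (hitWithin P o A n i.1).toReal)) ^ 2 with hf
  have hint : Integrable f μ := by
    simp only [hf, sq, Finset.sum_mul_sum]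
    exact integrable_finsetSum _ fun i _ => integrable_finsetSum _ fun j _ =>
      integrable_score_sub_mul i j K
  have hmarkov := mul_meas_ge_le_integral_of_nonneg (μ := μ) (f := f)
    (.of_forall fun ω => sq_nonneg _) hint ((a - c) ^ 2)
  have hpos : 0 < (a - c) ^ 2 := pow_pos (sub_pos.2 hc) 2
  have hle : μ.real {ω | (a - c) ^ 2 ≤ f ω} ≤ a / (a - c) ^ 2 := by
    rw [le_div_iff₀ hpos, mul_comm]
    exact hmarkov.trans (integral_sum_score_sub_sq_le F K)
  refine (measure_mono fun ω hω => ?_).trans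
    ((ofReal_measureReal (μ := μ)).symm.le.trans (ENNReal.ofReal_le_ofReal hle))
  have hω' : ∑ i ∈ F, (X.score o A n i K ω).toReal ≤ c := hω
  simp only [hf, Set.mem_ofPred_eq, Finset.sum_sub_distrib]
  rw [← ha]
  nlinarith

/-- The probability of few visits to `o`, in terms of the expected number of particles of a finite
set that hit `o` in a bounded number of steps. -/
lemma measure_visitTimes_lt_le (X : ActivatedRandomWalk η₀ P lam μ) (ho : o ∈ A)
    (hΛ : bigLambda P o A ≠ ∞) (r : ℕ) (F : Finset (Particle η₀)) (n : ℕ)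
    (hc : η₀ o + r + (bigLambda P o A).toReal < ∑ i ∈ F, (hitWithin P o A n i.1).toReal) :
    μ {ω | (X.visitTimes o ω).encard < r} ≤
      ENNReal.ofReal ((∑ i ∈ F, (hitWithin P o A n i.1).toReal) /
        ((∑ i ∈ F, (hitWithin P o A n i.1).toReal) -
          (η₀ o + r + (bigLambda P o A).toReal)) ^ 2) := by
  set c : ℝ := η₀ o + r + (bigLambda P o A).toReal with hcdef
  -- The ring count after which the deterministic bound holds depends on the outcome. The sets `B
  -- K₀` increase with `K₀`, so a bound uniform in `K₀` passes to their union.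
  set B : ℕ → Set Ω := fun K₀ => {ω | ∀ K ≥ K₀, ∑ i ∈ F, (X.score o A n i K ω).toReal ≤ c}
  have hmono : Monotone B := fun K₀ K₁ h ω hω K hK => hω K (h.trans hK)
  have hsub : {ω | (X.visitTimes o ω).encard < r} ≤ᵐ[μ] ⋃ K₀, B K₀ := by
    filter_upwards [X.ae_regular] with ω hω hr
    obtain ⟨K₀, hK₀⟩ := hω.sum_hitWithin_le ho hr F n
    refine Set.mem_iUnion.2 ⟨K₀, fun K hK => ?_⟩
    rw [← ENNReal.toReal_sum fun i _ => ((score_le_one i K ω).trans_lt ENNReal.one_lt_top).ne]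
    have hfin : (η₀ o : ℝ≥0∞) + r + bigLambda P o A ≠ ∞ := by simp [hΛ]
    have := ENNReal.toReal_mono hfin (hK₀ K hK)
    rw [ENNReal.toReal_add (by simp) hΛ, ENNReal.toReal_add (by simp) (by simp)] at this
    simpa [hcdef, score] using this
  refine (measure_mono_ae hsub).trans ?_
  rw [hmono.measure_iUnion]
  refine iSup_le fun K => (measure_mono ?_).trans
    (measure_sum_score_le (X := X) F K hc)
  exact fun ω hω => hω K le_rfl

end ActivatedRandomWalk

end Martingale

/-! ### Choice of parameters -/

section Conclusion

/-- A quotient `(Ω - Λ) / √Λ` that exceeds `K` forces `Λ` to be finite and `Ω` to exceed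
`Λ + K √Λ`. -/
lemma lt_of_lt_sub_div_sqrt {W L : ℝ≥0∞} (hL : 1 ≤ L) {K : ℝ} (hK : 0 ≤ K)
    (h : (K : EReal) < ((W : EReal) - (L : EReal)) / ((L ^ (1 / 2 : ℝ) : ℝ≥0∞) : EReal)) :
    L ≠ ∞ ∧ ENNReal.ofReal (L.toReal + K * √L.toReal) < W := by
  have hLtop : L ≠ ∞ := by
    rintro rfl
    -- In `EReal` division by `⊤` gives `0`, which cannot exceed `K ≥ 0`; so finiteness of `Λ` comes
    -- from the limit hypothesis itself.
    rw [ENNReal.top_rpow_of_pos (by norm_num), EReal.coe_ennreal_top, EReal.div_top] at h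
    exact absurd h (not_lt.2 (by exact_mod_cast hK))
  refine ⟨hLtop, ?_⟩
  by_cases hW : W = ∞
  · rw [hW]; exact ENNReal.ofReal_lt_top
  lift L to ℝ≥0 using hLtop
  lift W to ℝ≥0 using hW
  have hL1 : 1 ≤ L := by exact_mod_cast hL
  have hLpos : (0 : ℝ) < L := by exact_mod_cast zero_lt_one.trans_le hL1
  rw [← ENNReal.coe_rpow_of_nonneg _ (by norm_num)] at h
  change (K : EReal) < (((W : ℝ) : EReal) - ((L : ℝ) : EReal)) /
    ((((L ^ (1 / 2 : ℝ) : ℝ≥0)) : ℝ) : EReal) at h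
  rw [← EReal.coe_sub, ← EReal.coe_div, EReal.coe_lt_coe_iff, NNReal.coe_rpow,
    ← Real.sqrt_eq_rpow, lt_div_iff₀ (Real.sqrt_pos.2 hLpos)] at h
  rw [ENNReal.coe_toReal, ENNReal.ofReal_lt_coe_iff (by positivity)]
  linarith

/-- Here `L` is `Λ`, `d` the excess of the mean over `Λ`, and `C` the constant `η₀ o + r`. As `C ≤ d
/ 2`, the denominator is at least `d ^ 2 / 4`, while `L` and `d` are each at most `d ^ 2 / K`. -/
lemma div_sq_le_of_le {K C L d : ℝ} (hK : 1 ≤ K) (hKC : 2 * C ≤ K) (hL : 1 ≤ L)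
    (hd : K * √L ≤ d) : (L + d) / (d - C) ^ 2 ≤ 8 / K := by
  have hs : 1 ≤ √L := Real.one_le_sqrt.2 hL
  have hsq : √L * √L = L := Real.mul_self_sqrt (by linarith)
  have hdK : K ≤ d := by nlinarith
  have h1 : K ^ 2 * L ≤ d ^ 2 := by
    calc K ^ 2 * L = (K * √L) ^ 2 := by rw [mul_pow, sq (√L), hsq]
      _ ≤ d ^ 2 := by gcongr
  have h2 : d / 2 ≤ d - C := by linarith
  have h3 : (d / 2) ^ 2 ≤ (d - C) ^ 2 := by gcongr; linarith
  have h4 : 0 < (d / 2) ^ 2 := pow_pos (by linarith) 2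
  rw [div_le_div_iff₀ (h4.trans_le h3) (by linarith)]
  have h5 : K * L ≤ d ^ 2 := by
    refine le_trans ?_ h1
    gcongr
    nlinarith
  nlinarith

variable {S : Type u} [Countable S] [MeasurableSpace S] [DiscreteMeasurableSpace S] {η₀ : S → ℕ}
  {P : Kernel S S} [IsMarkovKernel P] {o : S} {A : Set S}

/-- Monotone approximation reduces to finitely many particles and boundedly many steps, which also
covers an infinite `bigOmega`. -/
lemma exists_lt_sum_hitWithin (ho : o ∈ A) {a : ℝ}
    (ha : ENNReal.ofReal a < bigOmega η₀ P o A) :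
    ∃ (F : Finset (Particle η₀)) (n : ℕ), a < ∑ i ∈ F, (hitWithin P o A n i.1).toReal := by
  rw [bigOmega_eq_tsum_particle η₀ ho, ENNReal.tsum_eq_iSup_sum, lt_iSup_iff] at ha
  obtain ⟨F, hF⟩ := ha
  have hlim : Tendsto (fun n => ∑ i ∈ F, hitWithin P o A n i.1) atTop
      (𝓝 (∑ i ∈ F, hitProb P o A i.1)) :=
    tendsto_finsetSum _ fun i _ => tendsto_hitWithin ho i.1
  obtain ⟨n, hn⟩ := (hlim.eventually_const_lt hF).exists
  refine ⟨F, n, ?_⟩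
  have hfin : ∀ i ∈ F, hitWithin P o A n i.1 ≠ ∞ := fun i _ =>
    ((hitWithin_le_one n i.1).trans_lt ENNReal.one_lt_top).ne
  rw [← ENNReal.toReal_sum hfin]
  refine not_le.1 fun h => hn.not_ge ?_
  rw [← ENNReal.ofReal_toReal (ENNReal.sum_ne_top.2 hfin)]
  exact ENNReal.ofReal_le_ofReal h

end Conclusion

end ARW

theorem mainTheorem2 {S : Type u} [Countable S] [MeasurableSpace S]
    [DiscreteMeasurableSpace S] (η₀ : S → ℕ) (P : Kernel S S) [IsMarkovKernel P] (o : S)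
    (A : ℕ → Set S) (ho : ∀ m, o ∈ A m)
    (hΔ : Tendsto (fun m => ARW.bigDelta η₀ P o (A m) /
      ((ARW.bigLambda P o (A m) ^ (1 / 2 : ℝ) : ℝ≥0∞) : EReal)) atTop (𝓝 ⊤)) :
    ARW.NonfixatingAt.{u, v} η₀ P o := by
  intro lam _ Ω _ μ _ X r
  set C : ℝ := η₀ o + r with hC
  have hC0 : 0 ≤ C := by positivity
  -- The event on the left does not depend on `A m`, so each `K` may use its own `m`; letting `K`
  -- grow shows that the event is null.
  have hbound : ∀ K : ℝ, max 1 (2 * C) ≤ K →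
      μ {ω | (X.visitTimes o ω).encard < r} ≤ ENNReal.ofReal (8 / K) := by
    intro K hK
    have hK1 : 1 ≤ K := (le_max_left _ _).trans hK
    have hK2 : 2 * C ≤ K := (le_max_right _ _).trans hK
    obtain ⟨m, hm⟩ := (hΔ.eventually_const_lt (EReal.coe_lt_top K)).exists
    have hΛ1 := ARW.one_le_bigLambda (P := P) (ho m)
    obtain ⟨hΛ, hΩ⟩ := ARW.lt_of_lt_sub_div_sqrt hΛ1 (zero_le_one.trans hK1) hm
    obtain ⟨F, n, hFn⟩ := ARW.exists_lt_sum_hitWithin (ho m) hΩ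
    set L := (ARW.bigLambda P o (A m)).toReal
    set a := ∑ i ∈ F, (ARW.hitWithin P o (A m) n i.1).toReal
    have hL1 : 1 ≤ L := by
      have := ENNReal.toReal_mono hΛ hΛ1
      simpa using this
    have hs : 1 ≤ √L := Real.one_le_sqrt.2 hL1
    have hlt : C + L < a := by nlinarith
    refine (X.measure_visitTimes_lt_le (ho m) hΛ r F n hlt).trans (ENNReal.ofReal_le_ofReal ?_)
    have := ARW.div_sq_le_of_le (L := L) (d := a - L) hK1 hK2 hL1 (by linarith)
    convert this using 2 <;> ring
  have hlim : Tendsto (fun K : ℝ => ENNReal.ofReal (8 / K)) atTop (𝓝 0) := by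
    simpa using ENNReal.tendsto_ofReal (tendsto_const_nhds.div_atTop tendsto_id)
  have hzero : μ {ω | (X.visitTimes o ω).encard < r} = 0 :=
    le_antisymm (ge_of_tendsto hlim ((eventually_ge_atTop _).mono hbound)) zero_le
  filter_upwards [measure_eq_zero_iff_ae_notMem.1 hzero] with ω hω using not_lt.1 hω
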